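/- Let $V$ be a finite-dimensional real normed vector space, $G$ a Zariski connected algebraic (that is, Zariski closed) subgroup of $\mathrm{GL}(V)$, and $W\subset V$ a $G$-invariant subspace; put $W'=V/W$. Assume: (H1) $G$ acts irreducibly and proximally on $W$ and on $W'$, where the action on a space $E$ is proximal if some rank-one endomorphism of $E$ is a limit of a sequence $t_n\gamma_n$ with $t_n>0$ and $\gamma_n$ in the image of $G$; (H2) the representations of $G$ in $W$ and $W'$ are not equivalent; (H3) $W$ has no $G$-invariant complementary subspace in $V$. Let $\mu$ be a Borel probability measure on $G$ with compact support, which is Zariski dense in the sense that the support of $\mu$ spans a Zariski dense subgroup of $G$. Let $\lambda_1$ and $\lambda_1'$ be the first Lyapunov exponents of $\mu$ in $W$ and in $W'$, that is, $\lambda_1=\lim_{n\to\infty}\frac1n\int_G\log\|g|_W\|\,d\mu^{*n}(g)$ and $\lambda_1'=\lim_{n\to\infty}\frac1n\int_G\log\|g|_{W'}\|\,d\mu^{*n}(g)$. Let $X_{V,W}=\mathbb P(V)\smallsetminus\mathbb P(W)$, and let $P_\mu$ be the Markov operator on the space $C(X_{V,W})$ of continuous real functions given by $P_\mu f(x)=\int_G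 f(gx)\,d\mu(g)$. Suppose $\lambda_1<\lambda_1'$. Then $P_\mu$ satisfies the uniform contraction hypothesis: there are a continuous proper function $u:X_{V,W}\to[0,\infty)$ (the inverse image of every compact set is relatively compact) and constants $0<a<1$ and $b>0$ such that $P_\mu u\le a\,u+b$ on $X_{V,W}$. Moreover, for every subspace $W_s$ of $V$ complementary to $W$, there are $\delta>0$, an integer $n_0\ge1$ and constants $0<a<1$, $b>0$ such that the function $u_\delta([w+w'])=\|w\|^\delta/\|w'\|^\delta$ (for $w\in W$, $w'\in W_s\smallsetminus\{0\}$) is continuous and proper on $X_{V,W}$ and satisfies $P_\mu^{n_0}u_\delta\le a\,u_\delta+b$ on $X_{V,W}$. -/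

import Mathlib

open MeasureTheory Filter Topology
open scoped LinearAlgebra.Projectivization

namespace AffineRW

/-! ### The Zariski topology on `GL(V)` -/

section Zariski

variable (V : Type*) [NormedAddCommGroup V] [NormedSpace ℝ V]

/-- The algebra of real polynomial functions on the vector space `End(V)`: the algebra of functions
generated by the linear forms. For finite-dimensional `V`, these are the polynomials in the
matrix entries. -/
def polyFun : Subalgebra ℝ ((V →L[ℝ] V) → ℝ) :=
  Algebra.adjoin ℝ {f | ∃ φ : (V →L[ℝ] V) →ₗ[ℝ] ℝ, f = fun A => φ A}

/-- The Zariski topology on `GL(V)`: the closed sets are the zero loci in `GL(V)` of sets of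
polynomial functions; the nonvanishing loci of single polynomial functions form a basis.
(Regular functions on `GL(V)` are quotients of polynomial functions by powers of the
determinant, so they have the same zero loci.) -/
@[reducible]
def zariski : TopologicalSpace (V →L[ℝ] V)ˣ :=
  TopologicalSpace.generateFrom
    {U | ∃ f ∈ polyFun V, U = {g : (V →L[ℝ] V)ˣ | f (g : V →L[ℝ] V) ≠ 0}}

variable {V}

/-- `G` is an algebraic subgroup of `GL(V)`: it is Zariski closed. -/
def IsAlgebraicSubgroup (G : Subgroup (V →L[ℝ] V)ˣ) : Prop :=
  IsClosed[zariski V] (G : Set (V →L[ℝ] V)ˣ)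

/-- `G` is connected for the Zariski topology. -/
def IsZariskiConnected (G : Subgroup (V →L[ℝ] V)ˣ) : Prop :=
  @IsConnected _ (zariski V) (G : Set (V →L[ℝ] V)ˣ)

/-- The measure `μ` on `G` is Zariski dense: the subgroup of `G` spanned by the support of `μ` is
Zariski dense in `G`. -/
def IsZariskiDense {G : Subgroup (V →L[ℝ] V)ˣ} [MeasurableSpace G] (μ : Measure G) : Prop :=
  (G : Set (V →L[ℝ] V)ˣ) ⊆
    @closure _ (zariski V) (((Subgroup.closure μ.support).map G.subtype :
      Subgroup (V →L[ℝ] V)ˣ) : Set (V →L[ℝ] V)ˣ)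

end Zariski

/-! ### Proximality and first Lyapunov exponent of a representation -/

section Rep

/-- A subspace of a finite-dimensional normed space is closed, so that its quotient is normed. -/
instance isClosed_submodule {V : Type*} [NormedAddCommGroup V] [NormedSpace ℝ V]
    [FiniteDimensional ℝ V] (W : Submodule ℝ V) : IsClosed (W : Set V) :=
  W.closed_of_finiteDimensional

variable {G : Type*} [Group G] {E : Type*} [NormedAddCommGroup E] [NormedSpace ℝ E]
  [FiniteDimensional ℝ E]

/-- The linear action `ρ` is proximal: some endomorphism of rank one is a limit of a sequence
`tₙ ρ(γₙ)` with `tₙ > 0` and `γₙ ∈ G`. -/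
def IsProximal (ρ : Representation ℝ G E) : Prop :=
  ∃ (π : E →L[ℝ] E) (t : ℕ → ℝ) (γ : ℕ → G),
    Module.finrank ℝ (LinearMap.range (π : E →ₗ[ℝ] E)) = 1 ∧ (∀ n, 0 < t n) ∧
      Tendsto (fun n => t n • LinearMap.toContinuousLinearMap (ρ (γ n))) atTop (𝓝 π)

/-- The convolution power `μ^{*n}` (law of a product of `n` independent elements of law `μ`). -/
noncomputable def convPow [MeasurableSpace G] (μ : Measure G) : ℕ → Measure G
  | 0 => Measure.dirac 1
  | n + 1 => Measure.mconv μ (convPow μ n)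

/-- `l` is the first Lyapunov exponent of `μ` in the representation `ρ`:
`l = lim (1/n) ∫ log ‖ρ(g)‖ dμ^{*n}(g)`, with the operator norm. -/
def IsFirstLyapunovExponent [MeasurableSpace G] (ρ : Representation ℝ G E) (μ : Measure G)
    (l : ℝ) : Prop :=
  Tendsto (fun n : ℕ => (1 / (n : ℝ)) *
    ∫ g, Real.log ‖LinearMap.toContinuousLinearMap (ρ g)‖ ∂(convPow μ n)) atTop (𝓝 l)

end Rep

/-! ### Markov operators and the uniform contraction hypothesis -/

section Markov

variable {X : Type*} [TopologicalSpace X]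

/-- The inverse image of every compact set is relatively compact. -/
def IsProperFun (u : X → ℝ) : Prop :=
  ∀ K : Set ℝ, IsCompact K → IsCompact (closure (u ⁻¹' K))

/-- The uniform contraction hypothesis for an operator `P` on the continuous functions on `X`. -/
def UniformContraction (P : Module.End ℝ C(X, ℝ)) : Prop :=
  ∃ u : C(X, ℝ), (∀ x, 0 ≤ u x) ∧ IsProperFun u ∧
    ∃ a b : ℝ, 0 < a ∧ a < 1 ∧ 0 < b ∧ ∀ x, P u x ≤ a * u x + b

variable {G : Type*} [TopologicalSpace G] [SecondCountableTopology G]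
  [MeasurableSpace G]

theorem restrict_support (μ : Measure G) : μ.restrict μ.support = μ :=
  Measure.restrict_eq_self_of_ae_mem (s := μ.support) Measure.support_mem_ae

variable [T2Space G] [BorelSpace G]

theorem integrable_of_compact_support (μ : Measure G) [IsFiniteMeasure μ]
    (hμ : IsCompact μ.support) {f : G → ℝ} (hf : Continuous f) : Integrable f μ := by
  have h : IntegrableOn f μ.support μ := hf.continuousOn.integrableOn_compact hμ
  rwa [IntegrableOn, restrict_support] at h

theorem continuous_integral (act : C(G × X, X)) (μ : Measure G) [IsFiniteMeasure μ]
    (hμ : IsCompact μ.support) (f : C(X, ℝ)) :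
    Continuous (fun x => ∫ g, f (act (g, x)) ∂μ) := by
  have : CompactSpace μ.support := isCompact_iff_compactSpace.mp hμ
  have hms : MeasurableSet μ.support := Measure.isClosed_support.measurableSet
  let F : C(X × μ.support, ℝ) :=
    ⟨fun p => f (act (p.2, p.1)), by fun_prop⟩
  have h1 : ∀ x, ∫ g, f (act (g, x)) ∂μ = ∫ g : μ.support, F.curry x g ∂(μ.comap (↑)) := by
    intro x
    have : ∫ g : μ.support, F.curry x g ∂(μ.comap (↑))
        = ∫ g in μ.support, f (act (g, x)) ∂μ :=
      integral_subtype_comap hms (fun g => f (act (g, x)))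
    rw [this, restrict_support]
  simp_rw [h1]
  have : IsFiniteMeasure (μ.comap (Subtype.val : μ.support → G)) := by
    constructor
    rw [comap_subtype_coe_apply hms]
    exact measure_lt_top _ _
  have h2 : Continuous fun φ : C(μ.support, ℝ) => ∫ g, φ g ∂(μ.comap (Subtype.val)) := by
    rw [continuous_iff_continuousAt]
    intro φ
    refine tendsto_integral_filter_of_norm_le_const ?_ ⟨‖φ‖ + 1, ?_⟩ ?_
    · exact Eventually.of_forall fun ψ => ψ.continuous.aestronglyMeasurable
    · have : ∀ᶠ ψ : C(μ.support, ℝ) in 𝓝 φ, ‖ψ‖ < ‖φ‖ + 1 :=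
        continuous_norm.continuousAt.eventually_lt_const (by simp)
      filter_upwards [this] with ψ hψ
      exact Eventually.of_forall fun g => (ψ.norm_coe_le_norm g).trans hψ.le
    · exact Eventually.of_forall fun g => (continuous_eval_const g).tendsto φ
  exact h2.comp F.curry.continuous

/-- The Markov operator `P_μ f(x) = ∫ f(gx) dμ(g)` of the random walk on `X` driven by `μ`, where
`G` acts continuously on `X` through `act`. -/
noncomputable def markovOperator (act : C(G × X, X)) (μ : Measure G) [IsFiniteMeasure μ]
    (hμ : IsCompact μ.support) : Module.End ℝ C(X, ℝ) where
  toFun f := ⟨fun x => ∫ g, f (act (g, x)) ∂μ, continuous_integral act μ hμ f⟩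
  map_add' f₁ f₂ := by
    ext x
    exact integral_add (integrable_of_compact_support μ hμ (by fun_prop))
      (integrable_of_compact_support μ hμ (by fun_prop))
  map_smul' c f := by
    ext x
    exact integral_const_mul c _

end Markov

/-! ### The space `X_{V,W} = P(V) \ P(W)` with the action of `G` -/

section Space

variable {V : Type*} [NormedAddCommGroup V] [NormedSpace ℝ V]

/-- The usual topology on the projective space: the quotient topology. -/
noncomputable instance projTopology : TopologicalSpace (ℙ ℝ V) :=
  TopologicalSpace.coinduced (Projectivization.mk' ℝ : {v : V // v ≠ 0} → ℙ ℝ V) inferInstance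

/-- `X_{V,W}`: the lines of `V` that are not contained in `W`, with the induced topology. -/
abbrev XVW (W : Submodule ℝ V) : Type _ := {x : ℙ ℝ V // ¬ x.submodule ≤ W}

/-- The point `[v]` of `X_{V,W}`, for a vector `v` outside `W`. -/
noncomputable def XVW.mk {W : Submodule ℝ V} (v : V) (hv : v ∉ W) : XVW W :=
  ⟨Projectivization.mk ℝ v (fun h => hv (h ▸ W.zero_mem)), by
    rwa [Projectivization.submodule_mk, Submodule.span_singleton_le_iff_mem]⟩

/-- The linear representation of `G ≤ GL(V)` on `V`. -/
noncomputable def stdRep (G : Subgroup (V →L[ℝ] V)ˣ) : Representation ℝ G V :=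
  Representation.ofDistribMulAction ℝ G V

theorem isOpenQuotientMap_mk' :
    IsOpenQuotientMap (Projectivization.mk' ℝ : {v : V // v ≠ 0} → ℙ ℝ V) := by
  refine ⟨Quotient.mk''_surjective, continuous_coinduced_rng, fun U hU => ?_⟩
  rw [isOpen_coinduced]
  have : (Projectivization.mk' ℝ : {v : V // v ≠ 0} → ℙ ℝ V) ⁻¹' (Projectivization.mk' ℝ '' U) =
      ⋃ c : ℝˣ, (fun v : {v : V // v ≠ 0} =>
        (⟨c • (v : V), (smul_ne_zero_iff_ne c).mpr v.2⟩ : {v : V // v ≠ 0})) ⁻¹' U := by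
    ext v
    simp only [Set.mem_preimage, Set.mem_image, Set.mem_iUnion]
    constructor
    · rintro ⟨w, hw, h⟩
      rw [Projectivization.mk'_eq_mk, Projectivization.mk'_eq_mk,
        Projectivization.mk_eq_mk_iff] at h
      obtain ⟨c, hc⟩ := h
      refine ⟨c, ?_⟩
      convert hw
    · rintro ⟨c, hc⟩
      refine ⟨_, hc, ?_⟩
      rw [Projectivization.mk'_eq_mk, Projectivization.mk'_eq_mk,
        Projectivization.mk_eq_mk_iff]
      exact ⟨c, rfl⟩
  rw [this]
  refine isOpen_iUnion fun c => hU.preimage ?_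
  exact Continuous.subtype_mk (continuous_subtype_val.const_smul c) _

theorem continuous_smul_proj (G : Subgroup (V →L[ℝ] V)ˣ) :
    Continuous (fun p : G × ℙ ℝ V => p.1 • p.2) := by
  have hq : IsOpenQuotientMap (Prod.map (id : G → G)
      (Projectivization.mk' ℝ : {v : V // v ≠ 0} → ℙ ℝ V)) :=
    IsOpenQuotientMap.id.prodMap isOpenQuotientMap_mk'
  rw [← hq.continuous_comp_iff]
  have hc : Continuous (fun p : G × {v : V // v ≠ 0} =>
      (⟨p.1 • (p.2 : V), (smul_ne_zero_iff_ne p.1).mpr p.2.2⟩ : {v : V // v ≠ 0})) := by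
    refine Continuous.subtype_mk ?_ _
    have h1 : Continuous (fun p : G × {v : V // v ≠ 0} => ((p.1 : (V →L[ℝ] V)ˣ) : V →L[ℝ] V)) :=
      Units.continuous_val.comp (continuous_subtype_val.comp continuous_fst)
    exact h1.clm_apply (continuous_subtype_val.comp continuous_snd)
  exact isOpenQuotientMap_mk'.continuous.comp hc

theorem smul_notMem (G : Subgroup (V →L[ℝ] V)ˣ) (W : Submodule ℝ V)
    (hW : ∀ g : G, W ≤ W.comap (stdRep G g)) (g : G) (x : ℙ ℝ V) (hx : ¬ x.submodule ≤ W) :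
    ¬ (g • x).submodule ≤ W := by
  induction x using Projectivization.ind with
  | h v hv =>
    have e : g • Projectivization.mk ℝ v hv =
        Projectivization.mk ℝ (g • v) ((smul_ne_zero_iff_ne g).mpr hv) := rfl
    rw [e]
    simp only [Projectivization.submodule_mk, Submodule.span_singleton_le_iff_mem] at hx ⊢
    intro h
    have h2 := hW g⁻¹ h
    rw [Submodule.mem_comap] at h2
    exact hx (by simpa [stdRep] using h2)

/-- The action `(g, x) ↦ gx` of `G` on `X_{V,W}`, for `W` invariant. -/
noncomputable def action (G : Subgroup (V →L[ℝ] V)ˣ) (W : Submodule ℝ V)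
    (hW : ∀ g : G, W ≤ W.comap (stdRep G g)) : C(G × XVW W, XVW W) where
  toFun p := ⟨p.1 • (p.2 : ℙ ℝ V), smul_notMem G W hW p.1 p.2 p.2.2⟩
  continuous_toFun := by
    refine Continuous.subtype_mk ?_ _
    exact (continuous_smul_proj G).comp
      (continuous_fst.prodMk (continuous_subtype_val.comp continuous_snd))

theorem secondCountable_GL [FiniteDimensional ℝ V] : SecondCountableTopology (V →L[ℝ] V)ˣ := by
  have : ProperSpace (V →L[ℝ] V) := FiniteDimensional.proper_real _
  have : SecondCountableTopology (V →L[ℝ] V)ᵐᵒᵖ :=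
    MulOpposite.opHomeomorph.symm.isEmbedding.secondCountableTopology
  exact Units.isEmbedding_embedProduct.secondCountableTopology

instance secondCountable_subgroup [FiniteDimensional ℝ V] (G : Subgroup (V →L[ℝ] V)ˣ) :
    SecondCountableTopology G :=
  have := secondCountable_GL (V := V)
  IsEmbedding.subtypeVal.secondCountableTopology

end Space

end AffineRW

/-!
# Uniform contraction for the random walk on `P(V) ∖ P(W)`

In a decomposition `V = W ⊕ Ws` the elements of `G` are block triangular. For `v = w + w'` the
`W`-component of `g v` is `g w` plus a term bounded by a multiple of `‖w'‖`, so that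
`u_δ([g v])` is at most `u_δ([v])` times the `δ`-th power of the relative expansion
`(‖g w‖ / ‖w‖) / (‖g w'‖ / ‖w'‖)`, where `g w'` is read in `V ⧸ W`, plus a constant
(`vecRatio_stdRep_le`). The contraction of `u_δ` by a power of the Markov operator thus amounts to
the mean of this power of the relative expansion being uniformly less than one
(`exists_moment_contraction`). For small `δ` this follows from `exp t ≤ 1 + t + t ^ 2` as soon as
the mean of the logarithm is uniformly negative, up to the constant comparing the norms of `Ws` and
`V ⧸ W`. The numerator is bounded by the operator norm, hence grows at rate at most `l`; what needs
proof is that in `V ⧸ W` all vectors grow at rate at least `l'`, uniformly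
(`eventually_le_integral_log_norm`).

This uniformity goes back to Furstenberg. If it failed, the averaged laws of the walk on the unit
sphere of `V ⧸ W`, started at vectors of slow growth, would accumulate at a stationary measure `ν`
(`exists_stationary`) of mean growth less than `l'`. But `ν` does not charge proper subspaces
(`measure_subspace_eq_zero`), so by compactness uniformly small neighbourhoods of hyperplanes have
small mass; as `‖h x‖` is comparable to `‖h‖` for `x` away from a hyperplane depending on `h`, the
mean growth for `ν` is at least the exponent `l'` (`lyapunov_le_integral_meanLogGrowth`).
That `ν` does not charge subspaces requires that no finite family of nonzero proper subspaces of
`V ⧸ W` be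
permuted by the support of `μ`. This holds since the subspaces in such a family would be permuted by
the Zariski closure `G` of the generated group, hence fixed by `G`, which is connected, against
irreducibility (`isStronglyIrreducibleOn_quotient`).

Finally a function contracted by a power of the operator is averaged into one contracted by the
operator itself (`uniformContraction_of_pow`).
-/

namespace AffineRW

/-! ### Convolution powers and powers of the Markov operator -/

section MarkovPositive

variable {G X : Type*} [TopologicalSpace G] [SecondCountableTopology G] [T2Space G]
  [MeasurableSpace G] [BorelSpace G] [TopologicalSpace X]

theorem markovOperator_nonneg (act : C(G × X, X)) (μ : Measure G) [IsProbabilityMeasure μ]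
    (hμ : IsCompact μ.support) {f : C(X, ℝ)} (hf : 0 ≤ f) : 0 ≤ markovOperator act μ hμ f :=
  fun _ => integral_nonneg fun _ => hf _

theorem markovOperator_one (act : C(G × X, X)) (μ : Measure G) [IsProbabilityMeasure μ]
    (hμ : IsCompact μ.support) : markovOperator act μ hμ 1 = 1 := by
  ext x
  change ∫ _, (1 : ℝ) ∂μ = 1
  simp

end MarkovPositive

section ConvPow

open scoped Pointwise

theorem isCompact_pow {G : Type*} [Group G] [TopologicalSpace G] [IsTopologicalGroup G]
    {K : Set G} (hK : IsCompact K) (n : ℕ) : IsCompact (K ^ n) := by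
  induction n with
  | zero => rw [pow_zero]; exact isCompact_singleton
  | succ n ih => rw [pow_succ]; exact ih.mul hK

variable {G : Type*} [Group G] [TopologicalSpace G] [IsTopologicalGroup G]
  [SecondCountableTopology G] [T2Space G] [MeasurableSpace G] [BorelSpace G]

instance isProbabilityMeasure_convPow (μ : Measure G) [IsProbabilityMeasure μ] (n : ℕ) :
    IsProbabilityMeasure (convPow μ n) := by
  induction n with
  | zero => exact Measure.dirac.isProbabilityMeasure
  | succ n ih => rw [convPow]; infer_instance

theorem ae_mem_pow_support (μ : Measure G) [IsProbabilityMeasure μ] (hμ : IsCompact μ.support)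
    (n : ℕ) : ∀ᵐ g ∂(convPow μ n), g ∈ μ.support ^ n := by
  induction n with
  | zero =>
    rw [convPow, ae_dirac_iff] <;> simp
  | succ n ih =>
    have hm : MeasurableSet {g | g ∈ μ.support ^ (n + 1)} :=
      (isCompact_pow hμ (n + 1)).isClosed.measurableSet
    rw [convPow, Measure.mconv, ae_map_iff (by fun_prop) hm]
    filter_upwards [Measure.quasiMeasurePreserving_fst.ae
      (Measure.support_mem_ae (μ := μ)), Measure.quasiMeasurePreserving_snd.ae ih] with p h1 h2
    rw [pow_succ']
    exact Set.mul_mem_mul h1 h2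

theorem isCompact_support_convPow (μ : Measure G) [IsProbabilityMeasure μ]
    (hμ : IsCompact μ.support) (n : ℕ) : IsCompact (convPow μ n).support :=
  (isCompact_pow hμ n).of_isClosed_subset Measure.isClosed_support
    (Measure.support_subset_of_isClosed (isCompact_pow hμ n).isClosed (ae_mem_pow_support μ hμ n))

theorem integrable_convPow (μ : Measure G) [IsProbabilityMeasure μ] (hμ : IsCompact μ.support)
    (n : ℕ) {f : G → ℝ} (hf : Continuous f) : Integrable f (convPow μ n) :=
  integrable_of_compact_support _ (isCompact_support_convPow μ hμ n) hf

theorem integral_convPow_succ (μ : Measure G) [IsProbabilityMeasure μ]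
    (hμ : IsCompact μ.support) (n : ℕ) {f : G → ℝ} (hf : Continuous f) :
    ∫ g, f g ∂(convPow μ (n + 1)) = ∫ g, ∫ h, f (h * g) ∂μ ∂(convPow μ n) := by
  have hi := integrable_convPow μ hμ (n + 1) hf
  rw [convPow] at hi ⊢
  rw [integral_mconv hi, integral_integral_swap]
  exact (integrable_map_measure hf.aestronglyMeasurable (by fun_prop)).1 hi

variable {X : Type*} [TopologicalSpace X]

theorem markovOperator_pow_apply (act : C(G × X, X)) (h1 : ∀ x, act (1, x) = x)
    (hmul : ∀ h g x, act (h * g, x) = act (h, act (g, x))) (μ : Measure G)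
    [IsProbabilityMeasure μ] (hμ : IsCompact μ.support) (n : ℕ) (f : C(X, ℝ)) (x : X) :
    (markovOperator act μ hμ ^ n) f x = ∫ g, f (act (g, x)) ∂(convPow μ n) := by
  induction n generalizing f with
  | zero =>
    rw [convPow, integral_dirac]
    simp [h1]
  | succ n ih =>
    rw [pow_succ, Module.End.mul_apply, ih, integral_convPow_succ μ hμ n (by fun_prop)]
    simp only [hmul]
    rfl

end ConvPow

/-! ### Stationary measures -/

section Stationary

variable {X : Type*} [TopologicalSpace X] [CompactSpace X]

theorem abs_pow_apply_le {P : Module.End ℝ C(X, ℝ)} (hpos : ∀ f, 0 ≤ f → 0 ≤ P f)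
    (hone : P 1 = 1) (n : ℕ) (f : C(X, ℝ)) (x : X) : |(P ^ n) f x| ≤ ‖f‖ := by
  have key : ∀ f : C(X, ℝ), ‖P f‖ ≤ ‖f‖ := by
    intro f
    rw [ContinuousMap.norm_le _ (norm_nonneg _)]
    intro x
    have h1 := hpos (‖f‖ • 1 - f) fun x => by
      simpa using (le_abs_self _).trans (f.norm_coe_le_norm x)
    have h2 := hpos (‖f‖ • 1 + f) fun x => by
      simpa using neg_le_iff_add_nonneg.1 ((neg_le_abs _).trans (f.norm_coe_le_norm x))
    have h1x := h1 x
    have h2x := h2 x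
    simp [hone] at h1x h2x
    rw [Real.norm_eq_abs, abs_le]
    constructor <;> linarith
  have : ‖(P ^ n) f‖ ≤ ‖f‖ := by
    induction n with
    | zero => simp
    | succ n ih =>
      rw [pow_succ', Module.End.mul_apply]
      exact (key _).trans ih
  exact ((P ^ n) f |>.norm_coe_le_norm x).trans this

variable [T2Space X] [MeasurableSpace X] [BorelSpace X]

/-- A positive functional on `C(X)` of mass one is the integral against a probability measure. -/
theorem exists_measure_of_functional (L : C(X, ℝ) →ₗ[ℝ] ℝ) (hpos : ∀ f, 0 ≤ f → 0 ≤ L f)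
    (hone : L 1 = 1) :
    ∃ ν : Measure X, IsProbabilityMeasure ν ∧ ∀ f : C(X, ℝ), ∫ x, f x ∂ν = L f := by
  let L' : CompactlySupportedContinuousMap X ℝ →ₗ[ℝ] ℝ :=
    { toFun := fun f => L f.toContinuousMap
      map_add' := fun f g => L.map_add _ _
      map_smul' := fun c f => L.map_smul _ _ }
  let Λ : CompactlySupportedContinuousMap X ℝ →ₚ[ℝ] ℝ :=
    PositiveLinearMap.mk₀ L' fun f hf => hpos _ hf
  have hint : ∀ f : C(X, ℝ), ∫ x, f x ∂(RealRMK.rieszMeasure Λ) = L f := fun f =>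
    RealRMK.integral_rieszMeasure Λ (CompactlySupportedContinuousMap.continuousMapEquiv f)
  refine ⟨RealRMK.rieszMeasure Λ, ⟨?_⟩, hint⟩
  have h := hint 1
  simp only [ContinuousMap.one_apply, integral_const, smul_eq_mul, mul_one, hone] at h
  rw [Measure.real, ENNReal.toReal_eq_one_iff] at h
  exact h

/-- Krylov–Bogolyubov: along an ultrafilter, the averages of the iterates of a Markov operator from
moving starting points converge to an invariant probability measure. -/
theorem exists_stationary (P : Module.End ℝ C(X, ℝ)) (hpos : ∀ f, 0 ≤ f → 0 ≤ P f)
    (hone : P 1 = 1) (U : Ultrafilter ℕ) (hU : (U : Filter ℕ) ≤ atTop) (x : ℕ → X) :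
    ∃ ν : Measure X, IsProbabilityMeasure ν ∧ (∀ f : C(X, ℝ), ∫ x, P f x ∂ν = ∫ x, f x ∂ν) ∧
      ∀ f : C(X, ℝ), Tendsto (fun n : ℕ => (n : ℝ)⁻¹ * ∑ j ∈ Finset.range n, (P ^ j) f (x n)) U
        (𝓝 (∫ x, f x ∂ν)) := by
  have hbd : ∀ f : C(X, ℝ), ∀ n : ℕ,
      (n : ℝ)⁻¹ * ∑ j ∈ Finset.range n, (P ^ j) f (x n) ∈ Metric.closedBall (0 : ℝ) ‖f‖ := by
    intro f n
    have h : |∑ j ∈ Finset.range n, (P ^ j) f (x n)| ≤ n * ‖f‖ := by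
      refine (Finset.abs_sum_le_sum_abs _ _).trans ?_
      refine (Finset.sum_le_sum fun j _ => abs_pow_apply_le hpos hone j f (x n)).trans ?_
      simp
    rw [mem_closedBall_zero_iff, Real.norm_eq_abs, abs_mul, abs_inv, Nat.abs_cast]
    rcases Nat.eq_zero_or_pos n with rfl | hn
    · simp
    · rwa [inv_mul_le_iff₀ (by exact_mod_cast hn)]
  have hlim : ∀ f : C(X, ℝ), ∃ a : ℝ,
      Tendsto (fun n : ℕ => (n : ℝ)⁻¹ * ∑ j ∈ Finset.range n, (P ^ j) f (x n)) U (𝓝 a) := by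
    intro f
    obtain ⟨a, -, ha⟩ := (isCompact_closedBall (0 : ℝ) ‖f‖).ultrafilter_le_nhds
      (U.map fun n : ℕ => (n : ℝ)⁻¹ * ∑ j ∈ Finset.range n, (P ^ j) f (x n)) (by
        rw [le_principal_iff]
        exact Filter.mem_map.2 (Filter.univ_mem' (hbd f)))
    exact ⟨a, ha⟩
  choose Λ hΛ using hlim
  let L : C(X, ℝ) →ₗ[ℝ] ℝ :=
    { toFun := Λ
      map_add' := fun f g => by
        refine tendsto_nhds_unique (hΛ (f + g)) (((hΛ f).add (hΛ g)).congr fun n => ?_)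
        simp [Finset.sum_add_distrib, mul_add]
      map_smul' := fun c f => by
        refine tendsto_nhds_unique (hΛ (c • f)) (((hΛ f).const_mul c).congr fun n => ?_)
        simp only [map_smul, ContinuousMap.smul_apply, smul_eq_mul, ← Finset.mul_sum]
        ring }
  have hPn : ∀ (n : ℕ) f, 0 ≤ f → 0 ≤ (P ^ n) f := by
    intro n f hf
    induction n with
    | zero => simpa
    | succ n ih => rw [pow_succ', Module.End.mul_apply]; exact hpos _ ih
  have hPone : ∀ n : ℕ, (P ^ n) 1 = 1 := by
    intro n
    induction n with
    | zero => simp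
    | succ n ih => rw [pow_succ', Module.End.mul_apply, ih, hone]
  have hLpos : ∀ f, 0 ≤ f → 0 ≤ L f := fun f hf =>
    ge_of_tendsto (hΛ f) (Eventually.of_forall fun n =>
      mul_nonneg (by positivity) (Finset.sum_nonneg fun j _ => hPn j f hf _))
  have hLone : L 1 = 1 := by
    refine tendsto_nhds_unique (hΛ 1) (tendsto_const_nhds.congr' ?_)
    filter_upwards [hU (eventually_ge_atTop 1)] with n hn
    have : (n : ℝ) ≠ 0 := by positivity
    simp [hPone, this]
  have hLinv : ∀ f, L (P f) = L f := by
    intro f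
    have h0 : Tendsto (fun n : ℕ => (n : ℝ)⁻¹ * (2 * ‖f‖)) U (𝓝 0) := by
      have := (tendsto_inv_atTop_nhds_zero_nat (𝕜 := ℝ)).mul_const (2 * ‖f‖)
      rw [zero_mul] at this
      exact this.mono_left hU
    have h1 : Tendsto (fun n : ℕ => (n : ℝ)⁻¹ * ∑ j ∈ Finset.range n, (P ^ j) (P f) (x n) -
        (n : ℝ)⁻¹ * ∑ j ∈ Finset.range n, (P ^ j) f (x n)) U (𝓝 0) := by
      refine squeeze_zero_norm (fun n => ?_) h0
      -- the difference of the two sums telescopes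
      rw [← mul_sub, ← Finset.sum_sub_distrib, norm_mul, norm_inv, Real.norm_natCast]
      have : ∑ j ∈ Finset.range n, ((P ^ j) (P f) (x n) - (P ^ j) f (x n)) =
          (P ^ n) f (x n) - (P ^ 0) f (x n) := by
        rw [← Finset.sum_range_sub (fun j => (P ^ j) f (x n))]
        refine Finset.sum_congr rfl fun j _ => ?_
        rw [pow_succ, Module.End.mul_apply]
      rw [this]
      gcongr
      refine (norm_sub_le _ _).trans ?_
      have h2 := abs_pow_apply_le hpos hone n f (x n)
      have h3 := abs_pow_apply_le hpos hone 0 f (x n)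
      rw [Real.norm_eq_abs, Real.norm_eq_abs]
      linarith
    exact sub_eq_zero.1 (tendsto_nhds_unique ((hΛ (P f)).sub (hΛ f)) h1)
  obtain ⟨ν, hν, hint⟩ := exists_measure_of_functional L hLpos hLone
  refine ⟨ν, hν, fun f => ?_, fun f => ?_⟩
  · rw [hint, hint, hLinv]
  · rw [hint]; exact hΛ f

end Stationary

/-! ### Representations on finite-dimensional normed spaces -/

section LinearAction

open scoped Pointwise

variable {G : Type*} [Group G] {E : Type*} [NormedAddCommGroup E] [NormedSpace ℝ E]

theorem rep_inv_apply_self (ρ : Representation ℝ G E) (g : G) (v : E) : ρ g⁻¹ (ρ g v) = v := by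
  rw [← Module.End.mul_apply, ← map_mul, inv_mul_cancel, map_one, Module.End.one_apply]

theorem rep_apply_ne_zero (ρ : Representation ℝ G E) (g : G) {v : E} (hv : v ≠ 0) :
    ρ g v ≠ 0 := fun h => hv <| by rw [← rep_inv_apply_self ρ g v, h, map_zero]

theorem finrank_comap_rep (ρ : Representation ℝ G E) (g : G) (U : Submodule ℝ E) :
    Module.finrank ℝ (U.comap (ρ g)) = Module.finrank ℝ U := by
  let e : E ≃ₗ[ℝ] E := LinearEquiv.ofLinearMap (ρ g) (ρ g⁻¹)
    (by ext v; simp) (by ext v; exact rep_inv_apply_self ρ g v)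
  have h : U.comap (ρ g) = U.map (e.symm : E →ₗ[ℝ] E) :=
    Submodule.comap_equiv_eq_map_symm e U
  rw [h]
  exact e.symm.finrank_map_eq U

theorem abs_log_norm_rep_sub_le (ρ : Representation ℝ G E) (g : G) {v : E} (hv : v ≠ 0) {D : ℝ}
    (h1 : Real.exp (-D) * ‖v‖ ≤ ‖ρ g v‖) (h2 : ‖ρ g v‖ ≤ Real.exp D * ‖v‖) :
    |Real.log ‖ρ g v‖ - Real.log ‖v‖| ≤ D := by
  have hv0 : 0 < ‖v‖ := norm_pos_iff.2 hv
  have hg : 0 < ‖ρ g v‖ := norm_pos_iff.2 (rep_apply_ne_zero ρ g hv)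
  rw [← Real.log_div hg.ne' hv0.ne', abs_le, Real.le_log_iff_exp_le (by positivity),
    Real.log_le_iff_le_exp (by positivity), le_div_iff₀ hv0, div_le_iff₀ hv0]
  exact ⟨h1, h2⟩

/-- A nonzero endomorphism does not contract vectors lying away from a suitable hyperplane
`ker f`. -/
theorem exists_functional_norm_mul_abs_le [FiniteDimensional ℝ E] (A : E →L[ℝ] E) (hA : A ≠ 0) :
    ∃ f : E →L[ℝ] ℝ, ‖f‖ = 1 ∧ ∀ x, ‖A‖ * |f x| ≤ ‖A x‖ := by
  have : ProperSpace E := FiniteDimensional.proper_real E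
  obtain ⟨x₁, hx₁⟩ : ∃ x, A x ≠ 0 := by
    by_contra! h
    exact hA (ContinuousLinearMap.ext h)
  have : Nontrivial E := ⟨x₁, 0, fun h => hx₁ (by simp [h])⟩
  obtain ⟨x₀, hx₀, hmax⟩ := (isCompact_sphere (0 : E) 1).exists_isMaxOn
    (NormedSpace.sphere_nonempty.2 zero_le_one) A.continuous.norm.continuousOn
  rw [mem_sphere_zero_iff_norm] at hx₀
  have hle : ‖A‖ ≤ ‖A x₀‖ := A.opNorm_le_of_unit_norm (norm_nonneg _) fun x hx =>
    hmax (mem_sphere_zero_iff_norm.2 hx)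
  have hA0 : 0 < ‖A‖ := norm_pos_iff.2 hA
  obtain ⟨y, hy, hyA⟩ := exists_dual_vector ℝ (A x₀) (hA0.trans_le hle).ne'
  have hyA' : ‖A‖ ≤ ‖y.comp A‖ := by
    calc ‖A‖ ≤ ‖A x₀‖ := hle
      _ = ‖(y.comp A) x₀‖ := by
        rw [ContinuousLinearMap.comp_apply, hyA]; simp
      _ ≤ ‖y.comp A‖ := by simpa [hx₀] using (y.comp A).le_opNorm x₀
  have hpos : 0 < ‖y.comp A‖ := hA0.trans_le hyA'
  refine ⟨‖y.comp A‖⁻¹ • y.comp A, ?_, fun x => ?_⟩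
  · rw [norm_smul, norm_inv, norm_norm, inv_mul_cancel₀ hpos.ne']
  · have h1 : |y (A x)| ≤ ‖A x‖ := by simpa [hy] using y.le_opNorm (A x)
    rw [smul_apply, smul_eq_mul, abs_mul, abs_inv, abs_norm,
      ContinuousLinearMap.comp_apply, ← mul_assoc]
    calc ‖A‖ * ‖y.comp A‖⁻¹ * |y (A x)| ≤ 1 * |y (A x)| := by
          gcongr
          rwa [← div_eq_mul_inv, div_le_one hpos]
      _ ≤ ‖A x‖ := by rwa [one_mul]

/-- Strong irreducibility along `S`: no nontrivial proper subspace belongs to a finite family of subspaces that is stable under the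
preimages by the elements of `S`. Preimages rather than images match the way stationarity is
used; all `ρ g` are invertible, so the notion is the same. -/
def IsStronglyIrreducibleOn (ρ : Representation ℝ G E) (S : Set G) : Prop :=
  ∀ F : Set (Submodule ℝ E), F.Finite → (∀ g ∈ S, ∀ U ∈ F, U.comap (ρ g) ∈ F) →
    ∀ U ∈ F, U = ⊥ ∨ U = ⊤

theorem isClosed_sphere_inter [FiniteDimensional ℝ E] (U : Submodule ℝ E) :
    IsClosed {x : Metric.sphere (0 : E) 1 | (x : E) ∈ U} :=
  U.closed_of_finiteDimensional.preimage continuous_subtype_val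

variable [FiniteDimensional ℝ E] [TopologicalSpace G]

theorem continuous_rep_apply {ρ : Representation ℝ G E}
    (hρ : Continuous fun g => LinearMap.toContinuousLinearMap (ρ g)) :
    Continuous fun p : G × E => ρ p.1 p.2 :=
  (hρ.comp continuous_fst).clm_apply continuous_snd

/-- The action of `G` on the space of nonzero vectors. -/
noncomputable def nonzeroAct (ρ : Representation ℝ G E)
    (hρ : Continuous fun g => LinearMap.toContinuousLinearMap (ρ g)) :
    C(G × {v : E // v ≠ 0}, {v : E // v ≠ 0}) where
  toFun p := ⟨ρ p.1 p.2, rep_apply_ne_zero ρ p.1 p.2.2⟩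
  continuous_toFun := Continuous.subtype_mk
    ((continuous_rep_apply hρ).comp (by fun_prop : Continuous fun p : G × {v : E // v ≠ 0} =>
      (p.1, (p.2 : E)))) _

/-- The action of `G` on the unit sphere, by `(g, x) ↦ gx / ‖gx‖`. -/
noncomputable def sphereAct (ρ : Representation ℝ G E)
    (hρ : Continuous fun g => LinearMap.toContinuousLinearMap (ρ g)) :
    C(G × Metric.sphere (0 : E) 1, Metric.sphere (0 : E) 1) where
  toFun p := ⟨‖ρ p.1 p.2‖⁻¹ • ρ p.1 p.2, by
    have h := rep_apply_ne_zero ρ p.1 (ne_zero_of_mem_unit_sphere p.2)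
    rw [mem_sphere_zero_iff_norm, norm_smul, norm_inv, norm_norm,
      inv_mul_cancel₀ (norm_ne_zero_iff.2 h)]⟩
  continuous_toFun := by
    have hc : Continuous fun p : G × Metric.sphere (0 : E) 1 => ρ p.1 p.2 :=
      (continuous_rep_apply hρ).comp
        (by fun_prop : Continuous fun p : G × Metric.sphere (0 : E) 1 => (p.1, (p.2 : E)))
    refine Continuous.subtype_mk ((hc.norm.inv₀ fun p => ?_).smul hc) _
    exact norm_ne_zero_iff.2 (rep_apply_ne_zero ρ p.1 (ne_zero_of_mem_unit_sphere p.2))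

variable (ρ : Representation ℝ G E)
    (hρ : Continuous fun g => LinearMap.toContinuousLinearMap (ρ g))

theorem coe_sphereAct (g : G) (x : Metric.sphere (0 : E) 1) :
    (sphereAct ρ hρ (g, x) : E) = ‖ρ g x‖⁻¹ • ρ g x := rfl

theorem sphereAct_one (x : Metric.sphere (0 : E) 1) : sphereAct ρ hρ (1, x) = x := by
  ext
  simp [coe_sphereAct]

theorem sphereAct_mul (h g : G) (x : Metric.sphere (0 : E) 1) :
    sphereAct ρ hρ (h * g, x) = sphereAct ρ hρ (h, sphereAct ρ hρ (g, x)) := by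
  ext
  have hg : ‖ρ g x‖ ≠ 0 :=
    norm_ne_zero_iff.2 (rep_apply_ne_zero ρ g (ne_zero_of_mem_unit_sphere x))
  simp only [coe_sphereAct, map_mul, Module.End.mul_apply, map_smul, norm_smul, norm_inv,
    norm_norm, mul_inv, inv_inv, smul_smul]
  congr 1
  field_simp

theorem sphereAct_mem_iff (g : G) (x : Metric.sphere (0 : E) 1) (U : Submodule ℝ E) :
    (sphereAct ρ hρ (g, x) : E) ∈ U ↔ (x : E) ∈ U.comap (ρ g) := by
  have hg : ‖ρ g x‖⁻¹ ≠ 0 := inv_ne_zero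
    (norm_ne_zero_iff.2 (rep_apply_ne_zero ρ g (ne_zero_of_mem_unit_sphere x)))
  rw [coe_sphereAct, U.smul_mem_iff hg, Submodule.mem_comap]

theorem log_norm_rep_mul (h g : G) (x : Metric.sphere (0 : E) 1) :
    Real.log ‖ρ (h * g) x‖ = Real.log ‖ρ g x‖ + Real.log ‖ρ h (sphereAct ρ hρ (g, x))‖ := by
  have hg : ‖ρ g x‖ ≠ 0 :=
    norm_ne_zero_iff.2 (rep_apply_ne_zero ρ g (ne_zero_of_mem_unit_sphere x))
  have hh : ‖ρ h (sphereAct ρ hρ (g, x))‖ ≠ 0 :=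
    norm_ne_zero_iff.2 (rep_apply_ne_zero ρ h (ne_zero_of_mem_unit_sphere _))
  rw [← Real.log_mul hg hh]
  congr 1
  rw [coe_sphereAct, map_smul, norm_smul, norm_inv, norm_norm, ← mul_assoc, mul_inv_cancel₀ hg,
    one_mul, map_mul, Module.End.mul_apply]

theorem continuous_log_norm_rep (ρ : Representation ℝ G E)
    (hρ : Continuous fun g => LinearMap.toContinuousLinearMap (ρ g)) {v : E} (hv : v ≠ 0) :
    Continuous fun g => Real.log ‖ρ g v‖ :=
  ((continuous_rep_apply hρ).comp
    (by fun_prop : Continuous fun g : G => (g, v))).norm.log fun g =>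
      norm_ne_zero_iff.2 (rep_apply_ne_zero ρ g hv)

/-- Over `n` steps, vectors grow or shrink at most exponentially in `n`. -/
theorem exists_exp_bound [IsTopologicalGroup G] (ρ : Representation ℝ G E)
    (hρ : Continuous fun g => LinearMap.toContinuousLinearMap (ρ g)) {K : Set G} (hK : IsCompact K) :
    ∃ C : ℝ, 0 ≤ C ∧ ∀ (n : ℕ), ∀ g ∈ K ^ n, ∀ v : E,
      Real.exp (-(C * n)) * ‖v‖ ≤ ‖ρ g v‖ ∧ ‖ρ g v‖ ≤ Real.exp (C * n) * ‖v‖ := by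
  obtain ⟨M₁, hM₁⟩ := hK.exists_bound_of_continuousOn hρ.continuousOn
  obtain ⟨M₂, hM₂⟩ := hK.exists_bound_of_continuousOn (hρ.comp continuous_inv).continuousOn
  obtain ⟨C, hC0, hC1, hC2⟩ : ∃ C : ℝ, 0 ≤ C ∧ M₁ ≤ Real.exp C ∧ M₂ ≤ Real.exp C := by
    refine ⟨max 0 (max M₁ M₂), le_max_left _ _, ?_, ?_⟩ <;>
    refine le_trans ?_ (Real.add_one_le_exp _)
    · linarith [le_max_right 0 (max M₁ M₂), le_max_left M₁ M₂]
    · linarith [le_max_right 0 (max M₁ M₂), le_max_right M₁ M₂]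
  have hup : ∀ g ∈ K, ∀ v : E, ‖ρ g v‖ ≤ Real.exp C * ‖v‖ := fun g hg v =>
    ContinuousLinearMap.le_of_opNorm_le (LinearMap.toContinuousLinearMap (ρ g))
      ((hM₁ g hg).trans hC1) v
  have hlow : ∀ g ∈ K, ∀ v : E, Real.exp (-C) * ‖v‖ ≤ ‖ρ g v‖ := by
    intro g hg v
    have h := ContinuousLinearMap.le_of_opNorm_le (LinearMap.toContinuousLinearMap (ρ g⁻¹))
      ((hM₂ g hg).trans hC2) (ρ g v)
    rw [LinearMap.coe_toContinuousLinearMap', rep_inv_apply_self] at h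
    rwa [Real.exp_neg, inv_mul_le_iff₀ (Real.exp_pos C)]
  refine ⟨C, hC0, fun n => ?_⟩
  induction n with
  | zero =>
    intro g hg v
    rw [pow_zero, Set.mem_one] at hg
    simp [hg]
  | succ n ih =>
    intro g hg v
    rw [pow_succ] at hg
    obtain ⟨a, ha, b, hb, rfl⟩ := Set.mem_mul.1 hg
    rw [map_mul, Module.End.mul_apply]
    have e1 : Real.exp (-(C * (n + 1 : ℕ))) = Real.exp (-(C * n)) * Real.exp (-C) := by
      rw [← Real.exp_add]; push_cast; ring_nf
    have e2 : Real.exp (C * (n + 1 : ℕ)) = Real.exp (C * n) * Real.exp C := by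
      rw [← Real.exp_add]; push_cast; ring_nf
    obtain ⟨i1, i2⟩ := ih a ha (ρ b v)
    rw [e1, e2, mul_assoc, mul_assoc]
    exact ⟨(mul_le_mul_of_nonneg_left (hlow b hb v) (Real.exp_pos _).le).trans i1,
      i2.trans (mul_le_mul_of_nonneg_left (hup b hb v) (Real.exp_pos _).le)⟩

end LinearAction

/-! ### Stationary measures do not charge proper subspaces -/

section Nonconcentration

variable {G : Type*} [Group G] [TopologicalSpace G]
  [SecondCountableTopology G] [T2Space G] [MeasurableSpace G] [BorelSpace G]
  {E : Type*} [NormedAddCommGroup E] [NormedSpace ℝ E] [FiniteDimensional ℝ E]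
  [MeasurableSpace (Metric.sphere (0 : E) 1)] [BorelSpace (Metric.sphere (0 : E) 1)]

theorem measure_subspace_eq_lintegral (ρ : Representation ℝ G E)
    (hρ : Continuous fun g => LinearMap.toContinuousLinearMap (ρ g))
    (μ : Measure G) [IsProbabilityMeasure μ] (hμ : IsCompact μ.support)
    (ν : Measure (Metric.sphere (0 : E) 1)) [IsProbabilityMeasure ν]
    (hν : ∀ f, ∫ x, markovOperator (sphereAct ρ hρ) μ hμ f x ∂ν = ∫ x, f x ∂ν)
    (U : Submodule ℝ E) :
    ν {x | (x : E) ∈ U} = ∫⁻ g, ν {x | (x : E) ∈ U.comap (ρ g)} ∂μ := by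
  have : ProperSpace E := FiniteDimensional.proper_real E
  have hact : Measurable (sphereAct ρ hρ) := (sphereAct ρ hρ).continuous.measurable
  have : IsProbabilityMeasure ((μ.prod ν).map (sphereAct ρ hρ)) :=
    Measure.isProbabilityMeasure_map hact.aemeasurable
  have hT : (μ.prod ν).map (sphereAct ρ hρ) = ν := by
    refine ext_of_forall_integral_eq_of_IsFiniteMeasure fun f => ?_
    have hint : Integrable (fun p => f (sphereAct ρ hρ p)) (μ.prod ν) :=
      Integrable.of_bound
        (f.continuous.comp (sphereAct ρ hρ).continuous).aestronglyMeasurable ‖f‖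
        (Eventually.of_forall fun p => f.norm_coe_le_norm _)
    rw [integral_map hact.aemeasurable f.continuous.aestronglyMeasurable,
      integral_prod_symm _ hint]
    exact hν f.toContinuousMap
  have hmeas : MeasurableSet {x : Metric.sphere (0 : E) 1 | (x : E) ∈ U} :=
    (isClosed_sphere_inter U).measurableSet
  conv_lhs => rw [← hT]
  rw [Measure.map_apply hact hmeas, Measure.prod_apply (hact hmeas)]
  refine lintegral_congr fun g => ?_
  congr 1
  ext x
  exact sphereAct_mem_iff ρ hρ g x U

/-- Furstenberg: a stationary measure of a strongly irreducible action gives mass zero to proper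
subspaces. The subspaces of minimal dimension with positive mass meet in null sets, so those of
maximal mass form a nonempty finite family, which the action preserves by stationarity. -/
theorem measure_subspace_eq_zero (ρ : Representation ℝ G E)
    (hρ : Continuous fun g => LinearMap.toContinuousLinearMap (ρ g))
    (μ : Measure G) [IsProbabilityMeasure μ] (hμ : IsCompact μ.support)
    (hirr : IsStronglyIrreducibleOn ρ μ.support)
    (ν : Measure (Metric.sphere (0 : E) 1)) [IsProbabilityMeasure ν]
    (hν : ∀ f, ∫ x, markovOperator (sphereAct ρ hρ) μ hμ f x ∂ν = ∫ x, f x ∂ν)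
    (U : Submodule ℝ E) (hU : U ≠ ⊤) : ν {x | (x : E) ∈ U} = 0 := by
  by_contra hU0
  let m : Submodule ℝ E → ENNReal := fun U => ν {x | (x : E) ∈ U}
  obtain ⟨U₀, ⟨hU₀, hU₀top⟩, hmin⟩ := WellFounded.has_min
    (measure fun U : Submodule ℝ E => Module.finrank ℝ U).wf {U | m U ≠ 0 ∧ U ≠ ⊤} ⟨U, hU0, hU⟩
  have hlt : Module.finrank ℝ U₀ < Module.finrank ℝ E := Submodule.finrank_lt hU₀top
  have hzero : ∀ U : Submodule ℝ E, Module.finrank ℝ U < Module.finrank ℝ U₀ → m U = 0 := by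
    intro U hU
    by_contra h
    refine hmin U ⟨h, ?_⟩ hU
    rintro rfl
    rw [finrank_top] at hU
    exact absurd hU hlt.not_gt
  -- finitely many, because they are almost disjoint in a probability space
  have hfin : {U : {U : Submodule ℝ E // Module.finrank ℝ U = Module.finrank ℝ U₀} |
      m U₀ ≤ m U}.Finite := by
    refine Measure.finite_const_le_meas_of_disjoint_iUnion₀ ν (pos_iff_ne_zero.2 hU₀)
      (As := fun U : {U : Submodule ℝ E // Module.finrank ℝ U = Module.finrank ℝ U₀} =>
        {x : Metric.sphere (0 : E) 1 | (x : E) ∈ (U : Submodule ℝ E)})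
      (fun U => (isClosed_sphere_inter _).measurableSet.nullMeasurableSet) ?_
      (measure_ne_top _ _)
    intro U₁ U₂ hne
    refine hzero (U₁.1 ⊓ U₂.1) ?_
    refine lt_of_lt_of_eq (Submodule.finrank_lt_finrank_of_lt (lt_of_le_of_ne inf_le_left fun h => hne ?_)) U₁.2
    exact Subtype.ext (Submodule.eq_of_le_of_finrank_eq (inf_eq_left.1 h) (U₁.2.trans U₂.2.symm))
  obtain ⟨⟨U₁, hU₁⟩, hU₁mem, hmax'⟩ := Set.exists_max_image _ (fun U => m U.1) hfin
    ⟨⟨U₀, rfl⟩, le_refl (m U₀)⟩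
  have hmax : ∀ U : Submodule ℝ E, Module.finrank ℝ U = Module.finrank ℝ U₀ → m U ≤ m U₁ := by
    intro U hU
    rcases le_total (m U₀) (m U) with h | h
    · exact hmax' ⟨U, hU⟩ h
    · exact h.trans hU₁mem
  let F : Set (Submodule ℝ E) := {U | Module.finrank ℝ U = Module.finrank ℝ U₀ ∧ m U = m U₁}
  have hF : F.Finite := by
    refine (hfin.image Subtype.val).subset ?_
    rintro U ⟨h1, h2⟩
    exact ⟨⟨U, h1⟩, hU₁mem.trans h2.ge, rfl⟩
  have hstab : ∀ g ∈ μ.support, ∀ U ∈ F, U.comap (ρ g) ∈ F := by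
    intro g hg U hUF
    have hae : ∀ᵐ g ∂μ, U.comap (ρ g) ∈ F := by
      -- `m U` is the maximum and also the mean of the `m (U.comap (ρ g))`
      have hle : ∀ g, m (U.comap (ρ g)) ≤ m U₁ := fun g =>
        hmax _ ((finrank_comap_rep ρ g U).trans hUF.1)
      have hinv : m U = ∫⁻ g, m (U.comap (ρ g)) ∂μ :=
        measure_subspace_eq_lintegral ρ hρ μ hμ ν hν U
      have heq := ae_eq_of_ae_le_of_lintegral_le (f := fun g => m (U.comap (ρ g)))
        (g := fun _ => m U₁) (Eventually.of_forall hle)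
        (by rw [← hinv]; exact measure_ne_top _ _) aemeasurable_const
        (by rw [← hinv, hUF.2]; simp)
      filter_upwards [heq] with g hg
      exact ⟨(finrank_comap_rep ρ g U).trans hUF.1, hg⟩
    have hset : {g | U.comap (ρ g) ∈ F} = ⋃ U' ∈ F, {g | ∀ u ∈ U', ρ g u ∈ U} := by
      ext g
      simp only [Set.mem_ofPred_eq, Set.mem_iUnion, exists_prop]
      constructor
      · exact fun h => ⟨_, h, fun u hu => hu⟩
      · rintro ⟨U', hU', h⟩
        have : U' = U.comap (ρ g) := Submodule.eq_of_le_of_finrank_eq h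
          (hU'.1.trans (hUF.1.symm.trans (finrank_comap_rep ρ g U).symm))
        rwa [← this]
    have hclosed : IsClosed {g | U.comap (ρ g) ∈ F} := by
      rw [hset]
      refine hF.isClosed_biUnion fun U' _ => ?_
      simp only [Set.ofPred_forall]
      refine isClosed_iInter fun u => isClosed_iInter fun _ => ?_
      exact U.closed_of_finiteDimensional.preimage
        ((continuous_rep_apply hρ).comp (by fun_prop : Continuous fun g : G => (g, u)))
    exact Measure.support_subset_of_isClosed hclosed hae hg
  rcases hirr F hF hstab U₁ ⟨hU₁, rfl⟩ with h | h
  · refine hU₀ (le_antisymm (hU₁mem.trans (le_of_eq ?_)) (zero_le))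
    have : {x : Metric.sphere (0 : E) 1 | (x : E) ∈ U₁} = ∅ := by
      ext x
      simpa [h] using ne_zero_of_mem_unit_sphere x
    change ν {x | (x : E) ∈ U₁} = 0
    rw [this, measure_empty]
  · rw [h, finrank_top] at hU₁
    exact hlt.ne' hU₁

/-- If all hyperplanes are null, then neighbourhoods of hyperplanes have uniformly small
mass, by compactness of the dual sphere. -/
theorem exists_uniform_small_mass (ν : Measure (Metric.sphere (0 : E) 1)) [IsProbabilityMeasure ν]
    (hν : ∀ U : Submodule ℝ E, U ≠ ⊤ → ν {x | (x : E) ∈ U} = 0) {η : ℝ} (hη : 0 < η) :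
    ∃ ε : ℝ, 0 < ε ∧ ε ≤ 1 ∧ ∀ f : E →L[ℝ] ℝ, ‖f‖ = 1 → ν.real {x | |f x| ≤ ε} ≤ η := by
  by_contra! H
  -- `f k` is a functional whose hyperplane has a `1 / (k + 1)`-neighbourhood of mass above `η`
  have H' : ∀ k : ℕ, ∃ f : E →L[ℝ] ℝ, ‖f‖ = 1 ∧ η < ν.real {x | |f x| ≤ 1 / ((k : ℝ) + 1)} :=
    fun k => H _ (by positivity) (by
      rw [div_le_one (by positivity)]; linarith [(Nat.cast_nonneg k : (0 : ℝ) ≤ k)])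
  choose f hf hfη using H'
  have : ProperSpace (E →L[ℝ] ℝ) := FiniteDimensional.proper_real _
  obtain ⟨f₀, hf₀, φ, hφ, hlim⟩ := (isCompact_sphere (0 : E →L[ℝ] ℝ) 1).tendsto_subseq
    (fun k => mem_sphere_zero_iff_norm.2 (hf k))
  rw [mem_sphere_zero_iff_norm] at hf₀
  let A : ℕ → Set (Metric.sphere (0 : E) 1) := fun k => {x | |f₀ x| ≤ 1 / ((k : ℝ) + 1)}
  have hA : ∀ k, ENNReal.ofReal η ≤ ν (A k) := by
    intro k
    have hpos : (0 : ℝ) < 1 / ((k : ℝ) + 1) / 2 := by positivity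
    have h1 : ∀ᶠ j in atTop, ‖f (φ j) - f₀‖ < 1 / ((k : ℝ) + 1) / 2 := by
      simpa [dist_eq_norm] using (Metric.tendsto_nhds.1 hlim) _ hpos
    have h2 : ∀ᶠ j in atTop, 1 / ((φ j : ℝ) + 1) < 1 / ((k : ℝ) + 1) / 2 :=
      ((tendsto_one_div_add_atTop_nhds_zero_nat (𝕜 := ℝ)).comp
        hφ.tendsto_atTop).eventually_lt_const hpos
    obtain ⟨j, hj1, hj2⟩ := (h1.and h2).exists
    refine (ENNReal.ofReal_le_ofReal (hfη (φ j)).le).trans ?_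
    rw [Measure.real, ENNReal.ofReal_toReal (measure_ne_top _ _)]
    refine measure_mono fun x hx => ?_
    have h3 : |(f (φ j) - f₀) x| ≤ ‖f (φ j) - f₀‖ := by
      simpa using (f (φ j) - f₀).le_opNorm x
    have h4 : |f (φ j) x| ≤ 1 / ((φ j : ℝ) + 1) := hx
    change |f₀ x| ≤ 1 / ((k : ℝ) + 1)
    have h5 : f₀ x = f (φ j) x - (f (φ j) - f₀) x := by simp
    rw [h5]
    refine (abs_sub _ _).trans ?_
    linarith
  -- the neighbourhoods of `ker f₀` of mass at least `η` decrease to a null set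
  have hinter : ⋂ k, A k ⊆ {x | (x : E) ∈ LinearMap.ker (f₀ : E →ₗ[ℝ] ℝ)} := by
    intro x hx
    rw [Set.mem_iInter] at hx
    have h : |f₀ x| ≤ 0 := ge_of_tendsto (tendsto_one_div_add_atTop_nhds_zero_nat (𝕜 := ℝ))
      (Eventually.of_forall hx)
    exact abs_nonpos_iff.1 h
  have hker : LinearMap.ker (f₀ : E →ₗ[ℝ] ℝ) ≠ ⊤ := by
    intro h
    rw [LinearMap.ker_eq_top] at h
    have : f₀ = 0 := ContinuousLinearMap.ext fun x => LinearMap.congr_fun h x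
    simp [this] at hf₀
  have hanti : Antitone A := fun i j hij x hx =>
    le_trans (show |f₀ x| ≤ 1 / ((j : ℝ) + 1) from hx) (one_div_le_one_div_of_le (by positivity)
      (by gcongr))
  have hlimA := tendsto_measure_iInter_atTop (μ := ν) (s := A)
    (fun k => (isClosed_le (by fun_prop) continuous_const).measurableSet.nullMeasurableSet)
    hanti ⟨0, measure_ne_top _ _⟩
  rw [measure_mono_null hinter (hν _ hker)] at hlimA
  have := ge_of_tendsto hlimA (Eventually.of_forall hA)
  simp only [nonpos_iff_eq_zero, ENNReal.ofReal_eq_zero] at this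
  linarith

end Nonconcentration

/-! ### Uniform growth of vectors at the rate of the first Lyapunov exponent -/

section Growth

open scoped Pointwise

variable {G : Type*} [Group G] [TopologicalSpace G] [IsTopologicalGroup G]
  [SecondCountableTopology G] [T2Space G] [MeasurableSpace G] [BorelSpace G]
  {E : Type*} [NormedAddCommGroup E] [NormedSpace ℝ E] [FiniteDimensional ℝ E]

/-- The mean one-step logarithmic growth `x ↦ ∫ log ‖gx‖ dμ(g)` on the unit sphere. -/
noncomputable def meanLogGrowth (ρ : Representation ℝ G E)
    (hρ : Continuous fun g => LinearMap.toContinuousLinearMap (ρ g))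
    (μ : Measure G) [IsProbabilityMeasure μ] (hμ : IsCompact μ.support) :
    C(Metric.sphere (0 : E) 1, ℝ) where
  toFun x := ∫ g, Real.log ‖ρ g x‖ ∂μ
  continuous_toFun :=
    (continuous_integral (nonzeroAct ρ hρ) μ hμ ⟨fun v => Real.log ‖(v : E)‖,
      continuous_subtype_val.norm.log fun v => norm_ne_zero_iff.2 v.2⟩).comp
    (Continuous.subtype_mk continuous_subtype_val fun x => ne_zero_of_mem_unit_sphere x)

variable (ρ : Representation ℝ G E)
    (hρ : Continuous fun g => LinearMap.toContinuousLinearMap (ρ g))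
    (μ : Measure G) [IsProbabilityMeasure μ] (hμ : IsCompact μ.support)

/-- The cocycle relation: the mean growth in `n` steps is a Birkhoff sum for the walk on the
sphere. -/
theorem integral_log_norm_convPow (n : ℕ) (x : Metric.sphere (0 : E) 1) :
    ∫ g, Real.log ‖ρ g x‖ ∂(convPow μ n) = ∑ j ∈ Finset.range n,
      (markovOperator (sphereAct ρ hρ) μ hμ ^ j) (meanLogGrowth ρ hρ μ hμ) x := by
  have hx : (x : E) ≠ 0 := ne_zero_of_mem_unit_sphere x
  induction n with
  | zero =>
    rw [convPow, integral_dirac]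
    simp
  | succ n ih =>
    rw [Finset.sum_range_succ, ← ih, integral_convPow_succ μ hμ n
      (continuous_log_norm_rep ρ hρ hx), markovOperator_pow_apply _ (sphereAct_one ρ hρ)
      (sphereAct_mul ρ hρ), ← integral_add
        (integrable_convPow μ hμ n (continuous_log_norm_rep ρ hρ hx))
        (integrable_convPow μ hμ n (by fun_prop))]
    refine integral_congr_ae (Eventually.of_forall fun g => ?_)
    simp only [log_norm_rep_mul ρ hρ]
    rw [integral_add (integrable_const _) (integrable_of_compact_support μ hμ
      (continuous_log_norm_rep ρ hρ (ne_zero_of_mem_unit_sphere _)))]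
    simp only [integral_const, probReal_univ, one_smul]
    rfl

/-- The mean growth with respect to a stationary measure that does not charge subspaces is at
least the first Lyapunov exponent: `‖hx‖` is comparable to `‖h‖` outside a neighbourhood of a
hyperplane, which has small mass, and inside it the loss is at most linear in `n`. -/
theorem lyapunov_le_integral_meanLogGrowth
    [MeasurableSpace (Metric.sphere (0 : E) 1)] [BorelSpace (Metric.sphere (0 : E) 1)]
    (hirr : IsStronglyIrreducibleOn ρ μ.support)
    (ν : Measure (Metric.sphere (0 : E) 1)) [IsProbabilityMeasure ν]
    (hν : ∀ f, ∫ x, markovOperator (sphereAct ρ hρ) μ hμ f x ∂ν = ∫ x, f x ∂ν)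
    {l : ℝ} (hl : IsFirstLyapunovExponent ρ μ l) :
    l ≤ ∫ x, meanLogGrowth ρ hρ μ hμ x ∂ν := by
  have : ProperSpace E := FiniteDimensional.proper_real E
  have hne : Nonempty (Metric.sphere (0 : E) 1) := ν.nonempty_of_neZero
  have hnt : Nontrivial E := ⟨(hne.some : E), 0, ne_zero_of_mem_unit_sphere _⟩
  obtain ⟨C, hC0, hC⟩ := exists_exp_bound ρ hρ hμ
  set S := ∫ x, meanLogGrowth ρ hρ μ hμ x ∂ν with hS
  have hpow : ∀ (n : ℕ) f, ∫ x, (markovOperator (sphereAct ρ hρ) μ hμ ^ n) f x ∂ν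
      = ∫ x, f x ∂ν := by
    intro n f
    induction n with
    | zero => simp
    | succ n ih => rw [pow_succ', Module.End.mul_apply, hν, ih]
  have hNne : ∀ g : G, 0 < ‖LinearMap.toContinuousLinearMap (ρ g)‖ := by
    intro g
    rw [norm_pos_iff]
    intro h
    exact rep_apply_ne_zero ρ g (ne_zero_of_mem_unit_sphere hne.some)
      (by simpa using congrArg (fun A : E →L[ℝ] E => A hne.some) h)
  have hlogc : Continuous fun p : G × Metric.sphere (0 : E) 1 => Real.log ‖ρ p.1 p.2‖ :=
    ((continuous_rep_apply hρ).comp (by fun_prop : Continuous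
      fun p : G × Metric.sphere (0 : E) 1 => (p.1, (p.2 : E)))).norm.log fun p =>
        norm_ne_zero_iff.2 (rep_apply_ne_zero ρ p.1 (ne_zero_of_mem_unit_sphere _))
  have hlogabs : ∀ (n : ℕ), ∀ g ∈ μ.support ^ n, ∀ x : Metric.sphere (0 : E) 1,
      |Real.log ‖ρ g x‖| ≤ C * n := by
    intro n g hg x
    have h := abs_log_norm_rep_sub_le ρ g (ne_zero_of_mem_unit_sphere x)
      (hC n g hg x).1 (hC n g hg x).2
    rwa [mem_sphere_zero_iff_norm.1 x.2, Real.log_one, sub_zero] at h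
  have hprod : ∀ n : ℕ, Integrable (fun p : G × Metric.sphere (0 : E) 1 =>
      Real.log ‖ρ p.1 p.2‖) ((convPow μ n).prod ν) := fun n =>
    Integrable.of_bound hlogc.aestronglyMeasurable (C * n) <| by
      filter_upwards [Measure.quasiMeasurePreserving_fst.ae (ae_mem_pow_support μ hμ n)]
        with p hp using hlogabs n p.1 hp p.2
  have hnS : ∀ n : ℕ, n * S = ∫ g, ∫ x, Real.log ‖ρ g x‖ ∂ν ∂(convPow μ n) := by
    intro n
    rw [integral_integral_swap (hprod n)]
    simp_rw [integral_log_norm_convPow ρ hρ μ hμ n]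
    rw [integral_finsetSum _ fun j _ => ?_]
    · simp [hpow, hS]
    · exact integrable_of_compact_support ν (Measure.isClosed_support.isCompact)
        (by fun_prop)
  refine le_of_forall_pos_le_add fun δ hδ => ?_
  obtain ⟨η, hη, hηC⟩ : ∃ η : ℝ, 0 < η ∧ 2 * C * η ≤ δ := by
    refine ⟨δ / (2 * C + 1), by positivity, ?_⟩
    rw [mul_div_assoc', div_le_iff₀ (by positivity)]
    nlinarith
  obtain ⟨ε, hε, hε1, hsmall⟩ := exists_uniform_small_mass ν
    (measure_subspace_eq_zero ρ hρ μ hμ hirr ν hν) hη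
  have hmain : ∀ n : ℕ, ∀ g ∈ μ.support ^ n,
      Real.log ‖LinearMap.toContinuousLinearMap (ρ g)‖ + (Real.log ε - 2 * C * η * n) ≤
        ∫ x, Real.log ‖ρ g x‖ ∂ν := by
    intro n g hg
    obtain ⟨f, hf, hfg⟩ := exists_functional_norm_mul_abs_le
      (LinearMap.toContinuousLinearMap (ρ g)) (norm_pos_iff.1 (hNne g))
    set N := ‖LinearMap.toContinuousLinearMap (ρ g)‖ with hN
    have hNle : Real.log N ≤ C * n := by
      rw [Real.log_le_iff_le_exp (hNne g)]
      exact ContinuousLinearMap.opNorm_le_bound _ (Real.exp_pos _).le fun v => (hC n g hg v).2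
    have hlogε : Real.log ε ≤ 0 := Real.log_nonpos hε.le hε1
    -- the set where the lower bound `‖g‖ * |f x|` of `‖g x‖` is useless; there the crude bound
    -- `exp (-C n)` costs at most `2 C n` compared with `log ‖g‖`
    let A : Set (Metric.sphere (0 : E) 1) := {x | |f x| ≤ ε}
    have hAm : MeasurableSet A := (isClosed_le (by fun_prop) continuous_const).measurableSet
    have hpt : ∀ x : Metric.sphere (0 : E) 1,
        (Real.log N + Real.log ε) - A.indicator (fun _ => 2 * C * n) x ≤ Real.log ‖ρ g x‖ := by
      intro x
      by_cases hx : x ∈ A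
      · rw [Set.indicator_of_mem hx]
        have := (abs_le.1 (hlogabs n g hg x)).1
        linarith
      · rw [Set.indicator_of_notMem hx, sub_zero, ← Real.log_mul (hNne g).ne' hε.ne']
        have hx' : ε < |f x| := not_le.1 hx
        refine Real.log_le_log (mul_pos (hNne g) hε) (le_trans ?_ (hfg x))
        exact mul_le_mul_of_nonneg_left hx'.le (hNne g).le
    have hA : ν.real A ≤ η := hsmall f hf
    have hind : Integrable (A.indicator (fun _ => 2 * C * (n : ℝ))) ν :=
      (integrable_const _).indicator hAm
    calc Real.log N + (Real.log ε - 2 * C * η * n)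
        ≤ Real.log N + Real.log ε - ν.real A * (2 * C * n) := by
          nlinarith [mul_le_mul_of_nonneg_right hA (by positivity : 0 ≤ 2 * C * (n : ℝ))]
      _ = ∫ x, ((Real.log N + Real.log ε) - A.indicator (fun _ => 2 * C * (n : ℝ)) x) ∂ν := by
          rw [integral_sub (integrable_const _) hind, integral_indicator_const _ hAm]
          simp
      _ ≤ _ := integral_mono ((integrable_const _).sub hind)
          (integrable_of_compact_support ν (Measure.isClosed_support.isCompact)
            (hlogc.comp (by fun_prop : Continuous fun x : Metric.sphere (0 : E) 1 => (g, x))))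
          hpt
  have hbound : ∀ n : ℕ, 1 ≤ n → (1 / (n : ℝ)) *
      ∫ g, Real.log ‖LinearMap.toContinuousLinearMap (ρ g)‖ ∂(convPow μ n)
        + (1 / (n : ℝ)) * Real.log ε ≤ S + 2 * C * η := by
    intro n hn
    have hn0 : (0 : ℝ) < n := by exact_mod_cast hn
    have hi : Integrable (fun g => Real.log ‖LinearMap.toContinuousLinearMap (ρ g)‖)
        (convPow μ n) := integrable_convPow μ hμ n (hρ.norm.log fun g => (hNne g).ne')
    have h1 : ∫ g, Real.log ‖LinearMap.toContinuousLinearMap (ρ g)‖ ∂(convPow μ n) +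
        (Real.log ε - 2 * C * η * n) ≤ n * S := by
      rw [hnS]
      calc _ = ∫ g, (Real.log ‖LinearMap.toContinuousLinearMap (ρ g)‖ +
            (Real.log ε - 2 * C * η * n)) ∂(convPow μ n) := by
            rw [integral_add hi (integrable_const _)]; simp
        _ ≤ _ := integral_mono_ae (hi.add (integrable_const _)) (hprod n).integral_prod_left
            ((ae_mem_pow_support μ hμ n).mono (hmain n))
    rw [← mul_add, one_div, inv_mul_le_iff₀ hn0]
    linarith
  have hlim : Tendsto (fun n : ℕ => (1 / (n : ℝ)) *
      ∫ g, Real.log ‖LinearMap.toContinuousLinearMap (ρ g)‖ ∂(convPow μ n)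
        + (1 / (n : ℝ)) * Real.log ε) atTop (𝓝 (l + 0 * Real.log ε)) :=
    hl.add (tendsto_one_div_atTop_nhds_zero_nat.mul_const _)
  have := le_of_tendsto hlim ((eventually_ge_atTop 1).mono hbound)
  linarith

/-- Under a strongly irreducible action all vectors grow on average at the rate of the first
Lyapunov exponent, uniformly in the vector. Otherwise, starting points of slow growth would yield
a stationary measure of mean growth below the exponent. -/
theorem eventually_le_integral_log_norm (hμ : IsCompact μ.support)
    (hρ : Continuous fun g => LinearMap.toContinuousLinearMap (ρ g))
    (hirr : IsStronglyIrreducibleOn ρ μ.support) {l : ℝ} (hl : IsFirstLyapunovExponent ρ μ l)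
    {ε : ℝ} (hε : 0 < ε) :
    ∀ᶠ n : ℕ in atTop, ∀ x : Metric.sphere (0 : E) 1,
      (l - ε) * n ≤ ∫ g, Real.log ‖ρ g x‖ ∂(convPow μ n) := by
  by_contra H
  have : ProperSpace E := FiniteDimensional.proper_real E
  let _ : MeasurableSpace (Metric.sphere (0 : E) 1) := borel _
  have : BorelSpace (Metric.sphere (0 : E) 1) := ⟨rfl⟩
  rw [not_eventually] at H
  -- the times at which some vector grows too slowly
  let B : Set ℕ := {n | ∃ x : Metric.sphere (0 : E) 1,
    ∫ g, Real.log ‖ρ g x‖ ∂(convPow μ n) < (l - ε) * n}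
  have hB : ∃ᶠ n in atTop, n ∈ B := H.mono fun n hn => by push Not at hn; exact hn
  have hx : ∀ n : ℕ, ∃ x : Metric.sphere (0 : E) 1, n ∈ B →
      ∫ g, Real.log ‖ρ g x‖ ∂(convPow μ n) < (l - ε) * n := by
    obtain ⟨n₀, x₀, -⟩ := hB.exists
    intro n
    by_cases h : n ∈ B
    · obtain ⟨x, hx⟩ := h
      exact ⟨x, fun _ => hx⟩
    · exact ⟨x₀, fun h' => absurd h' h⟩
  choose x hx using hx
  have hne : NeBot (atTop ⊓ 𝓟 B) := frequently_mem_iff_neBot.1 hB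
  have hof := Ultrafilter.of_le (atTop ⊓ 𝓟 B)
  obtain ⟨ν, hν, hstat, hlim⟩ := exists_stationary (markovOperator (sphereAct ρ hρ) μ hμ)
    (fun f hf => markovOperator_nonneg _ μ hμ hf) (markovOperator_one _ μ hμ)
    (Ultrafilter.of (atTop ⊓ 𝓟 B)) (hof.trans inf_le_left) x
  have h1 := lyapunov_le_integral_meanLogGrowth ρ hρ μ hμ hirr ν hstat hl
  have h2 : ∫ x, meanLogGrowth ρ hρ μ hμ x ∂ν ≤ l - ε := by
    refine le_of_tendsto (hlim _) ?_
    filter_upwards [le_principal_iff.1 (hof.trans inf_le_right),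
      hof.trans inf_le_left (eventually_ge_atTop 1)] with n hn hn1
    have hn0 : (0 : ℝ) < n := by exact_mod_cast hn1
    rw [← integral_log_norm_convPow ρ hρ μ hμ, inv_mul_le_iff₀ hn0, mul_comm]
    exact (hx n hn).le
  linarith

end Growth

/-! ### Strong irreducibility from Zariski connectedness -/

section ZariskiIrreducible

variable {V : Type*} [NormedAddCommGroup V] [NormedSpace ℝ V]

theorem isClosed_zariski_mapsTo (A B : Submodule ℝ V) :
    IsClosed[zariski V] {g : (V →L[ℝ] V)ˣ | ∀ v ∈ A, (g : V →L[ℝ] V) v ∈ B} := by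
  let _ : TopologicalSpace (V →L[ℝ] V)ˣ := zariski V
  have hset : {g : (V →L[ℝ] V)ˣ | ∀ v ∈ A, (g : V →L[ℝ] V) v ∈ B} =
      ⋂ v ∈ A, ⋂ φ : {φ : V →ₗ[ℝ] ℝ // B ≤ LinearMap.ker φ},
        {g : (V →L[ℝ] V)ˣ | φ.1 ((g : V →L[ℝ] V) v) = 0} := by
    ext g
    simp only [Set.mem_ofPred_eq, Set.mem_iInter]
    refine ⟨fun h v hv φ => φ.2 (h v hv), fun h v hv => ?_⟩
    by_contra hB
    obtain ⟨φ, hφ, hφB⟩ := Submodule.exists_le_ker_of_notMem hB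
    exact hφ (h v hv ⟨φ, hφB⟩)
  rw [hset]
  refine isClosed_biInter fun v _ => isClosed_iInter fun φ => ?_
  rw [← isOpen_compl_iff]
  refine TopologicalSpace.isOpen_generateFrom_of_mem
    ⟨fun A => φ.1 (A v), Algebra.subset_adjoin ⟨φ.1 ∘ₗ
      { toFun := fun A : V →L[ℝ] V => A v
        map_add' := fun _ _ => rfl
        map_smul' := fun _ _ => rfl }, rfl⟩, rfl⟩

variable [FiniteDimensional ℝ V]

/-- A finite family of subspaces of `V ⧸ W` stable under a subset generating a Zariski dense
subgroup of the connected group `G` is permuted by this subgroup. The elements of `G` mapping `U`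
to a given member of the family form finitely many disjoint closed sets covering `G`, so that
`U` is invariant. -/
theorem isStronglyIrreducibleOn_quotient (G : Subgroup (V →L[ℝ] V)ˣ)
    (hGconn : IsZariskiConnected G) (W : Submodule ℝ V)
    (hW : ∀ g : G, W ≤ W.comap (stdRep G g)) (hirr : ((stdRep G).quotient W hW).IsIrreducible)
    (S : Set G)
    (hS : (G : Set (V →L[ℝ] V)ˣ) ⊆ @closure _ (zariski V)
      (((Subgroup.closure S).map G.subtype : Subgroup (V →L[ℝ] V)ˣ) : Set (V →L[ℝ] V)ˣ)) :
    IsStronglyIrreducibleOn ((stdRep G).quotient W hW) S := by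
  intro F hF hstab U hU
  set ρ := (stdRep G).quotient W hW with hρ
  -- members of the family of the dimension of `U`, so that inclusions become equalities
  let F₀ : Set (Submodule ℝ (V ⧸ W)) :=
    {U₁ ∈ F | Module.finrank ℝ U₁ = Module.finrank ℝ U}
  have hF₀ : F₀.Finite := hF.subset fun _ h => h.1
  have hUF₀ : U ∈ F₀ := ⟨hU, rfl⟩
  have hmul : ∀ (a b : G) (U : Submodule ℝ (V ⧸ W)),
      U.comap (ρ (a * b)) = (U.comap (ρ a)).comap (ρ b) := by
    intro a b U
    rw [map_mul]
    rfl
  have hone : ∀ U : Submodule ℝ (V ⧸ W), U.comap (ρ 1) = U := by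
    intro U
    rw [map_one]
    rfl
  have hinv : ∀ (a : G) (U : Submodule ℝ (V ⧸ W)), (U.comap (ρ a)).comap (ρ a⁻¹) = U := by
    intro a U
    rw [← hmul, mul_inv_cancel, hone]
  have hperm : ∀ g ∈ Subgroup.closure S, ∀ U₁ ∈ F₀, U₁.comap (ρ g) ∈ F₀ := by
    intro g hg
    induction hg using Subgroup.closure_induction with
    | mem g hg =>
      exact fun U₁ h => ⟨hstab g hg U₁ h.1, (finrank_comap_rep ρ g U₁).trans h.2⟩
    | one => exact fun U₁ h => by rwa [hone]
    | mul a b _ _ ha hb => exact fun U₁ h => by rw [hmul]; exact hb _ (ha _ h)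
    | inv a _ ha =>
      intro U₁ h
      obtain ⟨U₂, hU₂, hU₂'⟩ := Set.surj_on_of_inj_on_of_ncard_le
        (s := F₀) (t := F₀) (fun U _ => U.comap (ρ a)) ha
        (fun U₂ U₃ _ _ h23 => by rw [← hinv a U₂, h23, hinv]) le_rfl hF₀ U₁ h
      rw [hU₂', hinv]
      exact hU₂
  let C : Submodule ℝ (V ⧸ W) → Set (V →L[ℝ] V)ˣ := fun U₁ =>
    {g | ∀ v ∈ U.comap W.mkQ, (g : V →L[ℝ] V) v ∈ U₁.comap W.mkQ}
  have hCmem : ∀ (g : G) (U₁ : Submodule ℝ (V ⧸ W)),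
      (g : (V →L[ℝ] V)ˣ) ∈ C U₁ ↔ U ≤ U₁.comap (ρ g) := by
    intro g U₁
    constructor
    · intro h x hx
      obtain ⟨v, rfl⟩ := W.mkQ_surjective x
      exact h v hx
    · intro h v hv
      exact h hv
  have hCeq : ∀ (g : G), ∀ U₁ ∈ F₀, (g : (V →L[ℝ] V)ˣ) ∈ C U₁ → U = U₁.comap (ρ g) :=
    fun g U₁ hU₁ hg => Submodule.eq_of_le_of_finrank_eq ((hCmem g U₁).1 hg)
      (hU₁.2.symm.trans (finrank_comap_rep ρ g U₁).symm)
  have hGC : (G : Set (V →L[ℝ] V)ˣ) ⊆ C U := by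
    let _ : TopologicalSpace (V →L[ℝ] V)ˣ := zariski V
    have hCclosed : ∀ U₁, IsClosed (C U₁) := fun U₁ => isClosed_zariski_mapsTo _ _
    have hcover : (G : Set (V →L[ℝ] V)ˣ) ⊆ ⋃ U₁ ∈ F₀, C U₁ := by
      refine hS.trans (closure_minimal ?_ (hF₀.isClosed_biUnion fun U₁ _ => hCclosed U₁))
      rintro _ ⟨g, hg, rfl⟩
      refine Set.mem_biUnion (hperm _ (inv_mem hg) U hUF₀) ((hCmem g _).2 ?_)
      rw [← hmul, inv_mul_cancel, hone]
    have hpre : IsPreconnected (G : Set (V →L[ℝ] V)ˣ) := hGconn.isPreconnected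
    rw [isPreconnected_closed_iff] at hpre
    have hD : IsClosed (⋃ U₁ ∈ F₀ \ {U}, C U₁) :=
      (hF₀.subset Set.sdiff_subset).isClosed_biUnion fun U₁ _ => hCclosed U₁
    have hcover' : (G : Set (V →L[ℝ] V)ˣ) ⊆ C U ∪ ⋃ U₁ ∈ F₀ \ {U}, C U₁ := by
      intro g hg
      obtain ⟨U₁, hU₁, hgU₁⟩ := Set.mem_iUnion₂.1 (hcover hg)
      by_cases h : U₁ = U
      · left; rwa [h] at hgU₁
      · right; exact Set.mem_biUnion (show U₁ ∈ F₀ \ {U} from ⟨hU₁, h⟩) hgU₁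
    intro g hg
    by_contra hgU
    obtain ⟨h, hhG, hhU, hhD⟩ := hpre _ _ (hCclosed U) hD hcover'
      ⟨1, G.one_mem, fun v hv => hv⟩ ⟨g, hg, (hcover' hg).resolve_left hgU⟩
    obtain ⟨U₁, hU₁, hhU₁⟩ := Set.mem_iUnion₂.1 hhD
    have e1 := hCeq ⟨h, hhG⟩ U hUF₀ hhU
    have e2 := hCeq ⟨h, hhG⟩ U₁ hU₁.1 hhU₁
    apply hU₁.2
    rw [Set.mem_singleton_iff, ← hinv ⟨h, hhG⟩ U₁, ← e2, e1, hinv, ← e1]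
  let σ : Subrepresentation ρ := ⟨U, fun g v hv => (hCmem g U).1 (hGC g.2) hv⟩
  rcases hirr.eq_bot_or_eq_top σ with h | h
  · left; exact congrArg Subrepresentation.toSubmodule h
  · right; exact congrArg Subrepresentation.toSubmodule h

end ZariskiIrreducible

/-! ### Exponential moments -/

section ExpMoment

open scoped Pointwise

/-- A bounded random variable of mean at most `-1` has a small exponential moment less than one. -/
theorem integral_exp_mul_le {Ω : Type*} [MeasurableSpace Ω] {m : Measure Ω}
    [IsProbabilityMeasure m] {s : Ω → ℝ} (hs : Integrable s m) {M : ℝ}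
    (hM : ∀ᵐ ω ∂m, |s ω| ≤ M) (hmean : ∫ ω, s ω ∂m ≤ -1) {δ : ℝ} (hδ : 0 < δ)
    (hδM : δ * M ≤ 1) (hδM2 : δ * M ^ 2 ≤ 1 / 2) :
    ∫ ω, Real.exp (δ * s ω) ∂m ≤ 1 - δ / 2 := by
  have hpt : ∀ᵐ ω ∂m, Real.exp (δ * s ω) ≤ (1 + δ / 2) + δ * s ω := by
    filter_upwards [hM] with ω hω
    have h0 : |δ * s ω| ≤ δ * M := by
      rw [abs_mul, abs_of_pos hδ]
      exact mul_le_mul_of_nonneg_left hω hδ.le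
    have h1 := (abs_le.1 (Real.abs_exp_sub_one_sub_id_le (h0.trans hδM))).2
    have h2 : (δ * s ω) ^ 2 ≤ (δ * M) ^ 2 := sq_le_sq' (abs_le.1 h0).1 (abs_le.1 h0).2
    nlinarith
  have hi : Integrable (fun ω => (1 + δ / 2) + δ * s ω) m :=
    (integrable_const _).add (hs.const_mul δ)
  calc ∫ ω, Real.exp (δ * s ω) ∂m ≤ ∫ ω, ((1 + δ / 2) + δ * s ω) ∂m :=
        integral_mono_of_nonneg (Eventually.of_forall fun _ => (Real.exp_pos _).le) hi hpt
    _ = (1 + δ / 2) + δ * ∫ ω, s ω ∂m := by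
        rw [integral_add (integrable_const _) (hs.const_mul δ), integral_const_mul]
        simp
    _ ≤ 1 - δ / 2 := by nlinarith

variable {G : Type*} [Group G] [TopologicalSpace G] [IsTopologicalGroup G]
  [SecondCountableTopology G] [T2Space G] [MeasurableSpace G] [BorelSpace G]
  {E : Type*} [NormedAddCommGroup E] [NormedSpace ℝ E] [FiniteDimensional ℝ E]
  {E' : Type*} [NormedAddCommGroup E'] [NormedSpace ℝ E'] [FiniteDimensional ℝ E']

theorem integral_log_norm_le (ρ : Representation ℝ G E)
    (hρ : Continuous fun g => LinearMap.toContinuousLinearMap (ρ g))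
    (μ : Measure G) [IsProbabilityMeasure μ] (hμ : IsCompact μ.support) (n : ℕ)
    {v : E} (hv : v ≠ 0) :
    ∫ g, (Real.log ‖ρ g v‖ - Real.log ‖v‖) ∂(convPow μ n) ≤
      ∫ g, Real.log ‖LinearMap.toContinuousLinearMap (ρ g)‖ ∂(convPow μ n) := by
  have hle : ∀ g, ‖ρ g v‖ ≤ ‖LinearMap.toContinuousLinearMap (ρ g)‖ * ‖v‖ := fun g =>
    (LinearMap.toContinuousLinearMap (ρ g)).le_opNorm v
  have hv0 : 0 < ‖v‖ := norm_pos_iff.2 hv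
  have hpos : ∀ g, 0 < ‖ρ g v‖ := fun g => norm_pos_iff.2 (rep_apply_ne_zero ρ g hv)
  have hN : ∀ g, 0 < ‖LinearMap.toContinuousLinearMap (ρ g)‖ := fun g =>
    pos_of_mul_pos_left ((hpos g).trans_le (hle g)) hv0.le
  refine integral_mono ((integrable_convPow μ hμ n (continuous_log_norm_rep ρ hρ hv)).sub
    (integrable_const _))
    (integrable_convPow μ hμ n (hρ.norm.log fun g => (hN g).ne')) fun g => ?_
  rw [sub_le_iff_le_add, ← Real.log_mul (hN g).ne' hv0.ne']
  exact Real.log_le_log (hpos g) (hle g)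

theorem eventually_le_integral_log_norm_sub (ρ : Representation ℝ G E)
    (hρ : Continuous fun g => LinearMap.toContinuousLinearMap (ρ g))
    (μ : Measure G) [IsProbabilityMeasure μ] (hμ : IsCompact μ.support)
    (hirr : IsStronglyIrreducibleOn ρ μ.support) {l : ℝ} (hl : IsFirstLyapunovExponent ρ μ l)
    {ε : ℝ} (hε : 0 < ε) :
    ∀ᶠ n : ℕ in atTop, ∀ v : E, v ≠ 0 →
      (l - ε) * n ≤ ∫ g, (Real.log ‖ρ g v‖ - Real.log ‖v‖) ∂(convPow μ n) := by
  filter_upwards [eventually_le_integral_log_norm ρ μ hμ hρ hirr hl hε] with n hn v hv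
  have hv0 : ‖v‖ ≠ 0 := norm_ne_zero_iff.2 hv
  refine (hn ⟨‖v‖⁻¹ • v, by
    rw [mem_sphere_zero_iff_norm, norm_smul, norm_inv, norm_norm, inv_mul_cancel₀ hv0]⟩).trans
      (le_of_eq ?_)
  refine integral_congr_ae (Eventually.of_forall fun g => ?_)
  simp only
  rw [map_smul, norm_smul, norm_inv, norm_norm, Real.log_mul (inv_ne_zero hv0)
    (norm_ne_zero_iff.2 (rep_apply_ne_zero ρ g hv)), Real.log_inv]
  ring

/-- If the first exponent in `E` is less than that in the strongly irreducible representation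
`E'`, a small moment of the relative expansion is uniformly contracted by a power of `μ`. The
factor `c` absorbs the comparison of norms. -/
theorem exists_moment_contraction (ρ : Representation ℝ G E) (ρ' : Representation ℝ G E')
    (hρ : Continuous fun g => LinearMap.toContinuousLinearMap (ρ g))
    (hρ' : Continuous fun g => LinearMap.toContinuousLinearMap (ρ' g))
    (μ : Measure G) [IsProbabilityMeasure μ] (hμ : IsCompact μ.support)
    (hirr : IsStronglyIrreducibleOn ρ' μ.support) {l l' : ℝ}
    (hl : IsFirstLyapunovExponent ρ μ l) (hl' : IsFirstLyapunovExponent ρ' μ l') (hlt : l < l')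
    {c : ℝ} (hc : 0 < c) :
    ∃ (n : ℕ) (δ a : ℝ), 1 ≤ n ∧ 0 < δ ∧ δ ≤ 1 ∧ 0 < a ∧ a < 1 ∧
      ∀ v : E, v ≠ 0 → ∀ v' : E', v' ≠ 0 →
        ∫ g, (c * (‖ρ g v‖ / ‖v‖) / (‖ρ' g v'‖ / ‖v'‖)) ^ δ ∂(convPow μ n) ≤ a := by
  set ε := (l' - l) / 4 with hε
  have hε0 : 0 < ε := by rw [hε]; linarith
  have hlarge : Tendsto (fun n : ℕ => (2 * ε) * (n : ℝ)) atTop atTop :=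
    tendsto_natCast_atTop_atTop.const_mul_atTop (by positivity)
  obtain ⟨n, hn1, hnW, hnQ, hnlarge⟩ := ((eventually_ge_atTop 1).and
    ((hl.eventually_lt_const (by linarith : l < l + ε)).and
      ((eventually_le_integral_log_norm_sub ρ' hρ' μ hμ hirr hl' hε0).and
        (hlarge.eventually_ge_atTop (Real.log c + 1))))).exists
  have hn0 : (0 : ℝ) < n := by exact_mod_cast hn1
  rw [one_div, inv_mul_lt_iff₀ hn0] at hnW
  obtain ⟨C, hC0, hC⟩ := exists_exp_bound ρ hρ hμ
  obtain ⟨C', hC'0, hC'⟩ := exists_exp_bound ρ' hρ' hμ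
  set M : ℝ := |Real.log c| + C * n + C' * n with hMdef
  have hM0 : 0 ≤ M := by positivity
  -- small enough for `δ * M ≤ 1` and `δ * M ^ 2 ≤ 1 / 2`
  set δ : ℝ := 1 / (2 * (M ^ 2 + M + 1)) with hδ
  have hδ0 : 0 < δ := by positivity
  have hδmul : δ * (2 * (M ^ 2 + M + 1)) = 1 := by
    rw [hδ]; field_simp
  have hδ1 : δ ≤ 1 := by nlinarith [mul_nonneg hδ0.le hM0, mul_nonneg hδ0.le (sq_nonneg M)]
  refine ⟨n, δ, 1 - δ / 2, hn1, hδ0, hδ1, by linarith, by linarith, fun v hv v' hv' => ?_⟩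
  -- the logarithm of the quantity whose moment is estimated
  let s : G → ℝ := fun g => Real.log c + (Real.log ‖ρ g v‖ - Real.log ‖v‖)
    - (Real.log ‖ρ' g v'‖ - Real.log ‖v'‖)
  have hi : Integrable (fun g => Real.log ‖ρ g v‖ - Real.log ‖v‖) (convPow μ n) :=
    (integrable_convPow μ hμ n (continuous_log_norm_rep ρ hρ hv)).sub (integrable_const _)
  have hi' : Integrable (fun g => Real.log ‖ρ' g v'‖ - Real.log ‖v'‖) (convPow μ n) :=
    (integrable_convPow μ hμ n (continuous_log_norm_rep ρ' hρ' hv')).sub (integrable_const _)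
  have hsi : Integrable s (convPow μ n) := ((integrable_const _).add hi).sub hi'
  have hmean : ∫ g, s g ∂(convPow μ n) ≤ -1 := by
    have h1 := integral_log_norm_le ρ hρ μ hμ n hv
    have h2 := hnQ v' hv'
    have h3 : ∫ g, s g ∂(convPow μ n) = Real.log c
        + ∫ g, (Real.log ‖ρ g v‖ - Real.log ‖v‖) ∂(convPow μ n)
        - ∫ g, (Real.log ‖ρ' g v'‖ - Real.log ‖v'‖) ∂(convPow μ n) := by
      have hci : Integrable (fun g => Real.log c + (Real.log ‖ρ g v‖ - Real.log ‖v‖))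
          (convPow μ n) := (integrable_const _).add hi
      rw [integral_sub hci hi', integral_add (integrable_const _) hi]
      simp
    have h4 : l' = l + 4 * ε := by rw [hε]; ring
    rw [h3]
    rw [h4] at h2
    linarith
  have hsM : ∀ᵐ g ∂(convPow μ n), |s g| ≤ M := by
    filter_upwards [ae_mem_pow_support μ hμ n] with g hg
    have h1 := abs_log_norm_rep_sub_le ρ g hv (hC n g hg v).1 (hC n g hg v).2
    have h2 := abs_log_norm_rep_sub_le ρ' g hv' (hC' n g hg v').1 (hC' n g hg v').2
    exact (abs_sub _ _).trans (add_le_add ((abs_add_le _ _).trans (add_le_add le_rfl h1)) h2)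
  refine le_trans (le_of_eq ?_) (integral_exp_mul_le hsi hsM hmean hδ0 ?_ ?_)
  · refine integral_congr_ae (Eventually.of_forall fun g => ?_)
    have p1 : 0 < ‖v‖ := norm_pos_iff.2 hv
    have p2 : 0 < ‖v'‖ := norm_pos_iff.2 hv'
    have p3 : 0 < ‖ρ g v‖ := norm_pos_iff.2 (rep_apply_ne_zero ρ g hv)
    have p4 : 0 < ‖ρ' g v'‖ := norm_pos_iff.2 (rep_apply_ne_zero ρ' g hv')
    simp only [s]
    rw [Real.rpow_def_of_pos (by positivity), Real.log_div (by positivity) (by positivity),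
      Real.log_mul (by positivity) (by positivity), Real.log_div p3.ne' p1.ne',
      Real.log_div p4.ne' p2.ne', mul_comm]
  · nlinarith [mul_nonneg hδ0.le hM0, mul_nonneg hδ0.le (sq_nonneg M)]
  · nlinarith [mul_nonneg hδ0.le hM0, mul_nonneg hδ0.le (sq_nonneg M)]

end ExpMoment

/-! ### From a power of the Markov operator to the operator itself -/

section PowContraction

variable {X : Type*} [TopologicalSpace X]

theorem isProperFun_of_isCompact_sublevel (u : C(X, ℝ)) (hu : ∀ M, IsCompact {x | u x ≤ M}) :
    IsProperFun u := by
  intro K hK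
  obtain ⟨M, hM⟩ := hK.bddAbove
  refine (hu M).of_isClosed_subset isClosed_closure (closure_minimal (fun x hx => hM hx) ?_)
  exact isClosed_le u.continuous continuous_const

/-- If a power `P ^ n` contracts `u` by a factor `α ^ n`, up to a constant, then `P` contracts
`∑ j < n, α ^ (n - 1 - j) P ^ j u` by `α`. -/
theorem uniformContraction_of_pow (P : Module.End ℝ C(X, ℝ)) (hpos : ∀ f, 0 ≤ f → 0 ≤ P f)
    (u : C(X, ℝ)) (hu0 : 0 ≤ u) (hu : ∀ M, IsCompact {x | u x ≤ M}) {n : ℕ} (hn : 1 ≤ n)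
    {a b : ℝ} (ha0 : 0 < a) (ha1 : a < 1) (hb : 0 < b)
    (hcontr : ∀ x, (P ^ n) u x ≤ a * u x + b) : UniformContraction P := by
  have hn0 : n ≠ 0 := by omega
  set α : ℝ := a ^ ((n : ℝ)⁻¹) with hα
  have hα0 : 0 < α := Real.rpow_pos_of_pos ha0 _
  have hα1 : α < 1 := Real.rpow_lt_one ha0.le ha1 (by positivity)
  have hαn : α ^ n = a := Real.rpow_inv_natCast_pow ha0.le hn0
  have hPn : ∀ j : ℕ, 0 ≤ (P ^ j) u := by
    intro j
    induction j with
    | zero => simpa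
    | succ j ih => rw [pow_succ', Module.End.mul_apply]; exact hpos _ ih
  let w : C(X, ℝ) := ∑ j ∈ Finset.range n, α ^ (n - 1 - j) • (P ^ j) u
  have hw : ∀ x, w x = ∑ j ∈ Finset.range n, α ^ (n - 1 - j) * (P ^ j) u x := by
    intro x
    simp [w, ContinuousMap.sum_apply]
  have hterm : ∀ x j, 0 ≤ α ^ (n - 1 - j) * (P ^ j) u x := fun x j =>
    mul_nonneg (by positivity) (hPn j x)
  have hwu : ∀ x, α ^ (n - 1) * u x ≤ w x := by
    intro x
    rw [hw]
    have := Finset.single_le_sum (f := fun j => α ^ (n - 1 - j) * (P ^ j) u x)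
      (fun j _ => hterm x j) (Finset.mem_range.2 hn)
    simpa using this
  refine ⟨w, fun x => ?_, isProperFun_of_isCompact_sublevel w fun M => ?_, α, b, hα0, hα1, hb,
    fun x => ?_⟩
  · rw [hw]; exact Finset.sum_nonneg fun j _ => hterm x j
  · refine (hu (M / α ^ (n - 1))).of_isClosed_subset
      (isClosed_le w.continuous continuous_const) fun x hx => ?_
    change u x ≤ _
    rw [le_div_iff₀ (by positivity), mul_comm]
    exact (hwu x).trans hx
  · have hPw : P w x = ∑ j ∈ Finset.range n, α ^ (n - (j + 1)) * (P ^ (j + 1)) u x := by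
      simp only [w, map_sum, map_smul, ContinuousMap.sum_apply, ContinuousMap.smul_apply,
        smul_eq_mul]
      refine Finset.sum_congr rfl fun j hj => ?_
      rw [pow_succ', Module.End.mul_apply, show n - (j + 1) = n - 1 - j by omega]
    have hαw : α * w x = ∑ j ∈ Finset.range n, α ^ (n - j) * (P ^ j) u x := by
      rw [hw, Finset.mul_sum]
      refine Finset.sum_congr rfl fun j hj => ?_
      have := Finset.mem_range.1 hj
      rw [← mul_assoc, ← pow_succ', show n - 1 - j + 1 = n - j by omega]
    have htel : P w x - α * w x = (P ^ n) u x - a * u x := by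
      rw [hPw, hαw, ← Finset.sum_sub_distrib,
        Finset.sum_range_sub (fun j => α ^ (n - j) * (P ^ j) u x)]
      simp [hαn]
    linarith [hcontr x]

end PowContraction

/-! ### The function `u_δ` on `X_{V,W}` -/

section Space

variable {V : Type*} [NormedAddCommGroup V] [NormedSpace ℝ V]

theorem XVW.mk_eq_mk_smul {W : Submodule ℝ V} {v : V} (hv : v ∉ W) {c : ℝ} (hc : c ≠ 0)
    (hcv : c • v ∉ W) : XVW.mk v hv = XVW.mk (c • v) hcv := by
  refine Subtype.ext ((Projectivization.mk_eq_mk_iff' ℝ _ _ _ _).2 ⟨c⁻¹, ?_⟩)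
  rw [smul_smul, inv_mul_cancel₀ hc, one_smul]

theorem XVW.exists_mk_eq {W : Submodule ℝ V} (x : XVW W) : ∃ v, ∃ hv : v ∉ W, x = XVW.mk v hv := by
  obtain ⟨x, hx⟩ := x
  induction x using Projectivization.ind with
  | h v hv =>
    rw [Projectivization.submodule_mk, Submodule.span_singleton_le_iff_mem] at hx
    exact ⟨v, hx, rfl⟩

theorem action_one (G : Subgroup (V →L[ℝ] V)ˣ) (W : Submodule ℝ V)
    (hW : ∀ g : G, W ≤ W.comap (stdRep G g)) (x : XVW W) : action G W hW (1, x) = x :=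
  Subtype.ext (one_smul G (x : ℙ ℝ V))

theorem action_mul (G : Subgroup (V →L[ℝ] V)ˣ) (W : Submodule ℝ V)
    (hW : ∀ g : G, W ≤ W.comap (stdRep G g)) (h g : G) (x : XVW W) :
    action G W hW (h * g, x) = action G W hW (h, action G W hW (g, x)) :=
  Subtype.ext (mul_smul h g (x : ℙ ℝ V))

theorem action_mk (G : Subgroup (V →L[ℝ] V)ˣ) (W : Submodule ℝ V)
    (hW : ∀ g : G, W ≤ W.comap (stdRep G g)) (g : G) (v : V) (hv : v ∉ W)
    (hgv : stdRep G g v ∉ W) :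
    action G W hW (g, XVW.mk v hv) = XVW.mk (stdRep G g v) hgv := rfl

theorem stdRep_apply_notMem (G : Subgroup (V →L[ℝ] V)ˣ) (W : Submodule ℝ V)
    (hW : ∀ g : G, W ≤ W.comap (stdRep G g)) (g : G) {v : V} (hv : v ∉ W) :
    stdRep G g v ∉ W := by
  intro h
  have h2 := hW g⁻¹ h
  rw [Submodule.mem_comap, rep_inv_apply_self] at h2
  exact hv h2

theorem isOpenQuotientMap_XVW_mk (W : Submodule ℝ V) :
    IsOpenQuotientMap fun v : {v : V // v ∉ W} => XVW.mk v.1 v.2 := by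
  have h := isOpenQuotientMap_mk' (V := V) |>.restrictPreimage {x | ¬ x.submodule ≤ W}
  let e : {v : V // v ∉ W} ≃ₜ
      ((Projectivization.mk' ℝ : {v : V // v ≠ 0} → ℙ ℝ V) ⁻¹' {x | ¬ x.submodule ≤ W}) :=
    { toFun := fun v => ⟨⟨v.1, fun h => v.2 (h ▸ W.zero_mem)⟩, by
        change ¬ (Projectivization.mk ℝ v.1 _).submodule ≤ W
        rw [Projectivization.submodule_mk, Submodule.span_singleton_le_iff_mem]
        exact v.2⟩
      invFun := fun v => ⟨v.1.1, by
        have hv : ¬ (Projectivization.mk ℝ v.1.1 v.1.2).submodule ≤ W := v.2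
        rwa [Projectivization.submodule_mk, Submodule.span_singleton_le_iff_mem] at hv⟩
      left_inv := fun v => rfl
      right_inv := fun v => rfl
      continuous_toFun := by fun_prop
      continuous_invFun := by fun_prop }
  exact h.comp e.isOpenQuotientMap

variable {W Ws : Submodule ℝ V}

/-- The function `v ↦ ‖w‖ ^ δ / ‖w'‖ ^ δ`, of interest on `V ∖ W`, for `v = w + w'` with `w ∈ W`, `w' ∈ Ws`. -/
noncomputable def vecRatio (hc : IsCompl W Ws) (δ : ℝ) (v : V) : ℝ :=
  ‖W.projection Ws hc v‖ ^ δ / ‖Ws.projection W hc.symm v‖ ^ δ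

theorem projection_ne_zero (hc : IsCompl W Ws) {v : V} (hv : v ∉ W) :
    0 < ‖Ws.projection W hc.symm v‖ :=
  norm_pos_iff.2 fun h => hv ((Submodule.projection_apply_eq_zero_iff hc.symm).1 h)

theorem vecRatio_smul (hc : IsCompl W Ws) (δ : ℝ) (v : V) {c : ℝ} (hc0 : c ≠ 0) :
    vecRatio hc δ (c • v) = vecRatio hc δ v := by
  have h : ‖c‖ ^ δ ≠ 0 := (Real.rpow_pos_of_pos (norm_pos_iff.2 hc0) δ).ne'
  rw [vecRatio, map_smul, map_smul, norm_smul, norm_smul,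
    Real.mul_rpow (norm_nonneg _) (norm_nonneg _), Real.mul_rpow (norm_nonneg _) (norm_nonneg _),
    mul_div_mul_left _ _ h, vecRatio]

theorem vecRatio_add (hc : IsCompl W Ws) (δ : ℝ) {w w' : V} (hw : w ∈ W) (hw' : w' ∈ Ws) :
    vecRatio hc δ (w + w') = ‖w‖ ^ δ / ‖w'‖ ^ δ := by
  rw [vecRatio, map_add, map_add, Submodule.projection_apply_of_mem_left hc hw,
    Submodule.projection_apply_of_mem_left hc.symm hw',
    (Submodule.projection_apply_eq_zero_iff hc).2 hw',
    (Submodule.projection_apply_eq_zero_iff hc.symm).2 hw, add_zero, zero_add]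

variable [FiniteDimensional ℝ V]

theorem continuous_projection (hc : IsCompl W Ws) : Continuous (W.projection Ws hc) :=
  LinearMap.continuous_of_finiteDimensional _

/-- The function `u_δ([w + w']) = ‖w‖ ^ δ / ‖w'‖ ^ δ` on `X_{V,W}`, where `w ∈ W`, `w' ∈ Ws`. -/
noncomputable def ratioFun (hc : IsCompl W Ws) {δ : ℝ} (hδ : 0 < δ) : C(XVW W, ℝ) where
  toFun x := vecRatio hc δ (x : ℙ ℝ V).rep
  continuous_toFun := by
    rw [← (isOpenQuotientMap_XVW_mk W).continuous_comp_iff]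
    have h : ((fun x : XVW W => vecRatio hc δ (x : ℙ ℝ V).rep) ∘
        fun v : {v : V // v ∉ W} => XVW.mk v.1 v.2) = fun v => vecRatio hc δ v.1 := by
      ext v
      have hv0 : v.1 ≠ 0 := fun h => v.2 (h ▸ W.zero_mem)
      obtain ⟨c, hcv⟩ := Projectivization.exists_smul_eq_mk_rep ℝ v.1 hv0
      change vecRatio hc δ (Projectivization.mk ℝ v.1 hv0).rep = _
      rw [← hcv, Units.smul_def, vecRatio_smul hc δ _ c.ne_zero]
    rw [h]
    refine Continuous.div ?_ ?_ fun v => ?_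
    · exact (((continuous_projection hc).comp continuous_subtype_val).norm).rpow_const
        fun _ => Or.inr hδ.le
    · exact (((continuous_projection hc.symm).comp continuous_subtype_val).norm).rpow_const
        fun _ => Or.inr hδ.le
    · exact (Real.rpow_pos_of_pos (projection_ne_zero hc v.2) δ).ne'

theorem ratioFun_mk (hc : IsCompl W Ws) {δ : ℝ} (hδ : 0 < δ) (v : V) (hv : v ∉ W) :
    ratioFun hc hδ (XVW.mk v hv) = vecRatio hc δ v := by
  have hv0 : v ≠ 0 := fun h => hv (h ▸ W.zero_mem)
  obtain ⟨c, hcv⟩ := Projectivization.exists_smul_eq_mk_rep ℝ v hv0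
  change vecRatio hc δ (Projectivization.mk ℝ v hv0).rep = _
  rw [← hcv, Units.smul_def, vecRatio_smul hc δ _ c.ne_zero]

theorem ratioFun_nonneg (hc : IsCompl W Ws) {δ : ℝ} (hδ : 0 < δ) : 0 ≤ ratioFun hc hδ :=
  fun _ => div_nonneg (Real.rpow_nonneg (norm_nonneg _) _) (Real.rpow_nonneg (norm_nonneg _) _)

/-- The sublevel sets of `u_δ` are images of compact sets of vectors `w + w'` with `‖w'‖ = 1`. -/
theorem isCompact_ratioFun_le (hc : IsCompl W Ws) {δ : ℝ} (hδ : 0 < δ) (M : ℝ) :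
    IsCompact {x | ratioFun hc hδ x ≤ M} := by
  have : ProperSpace V := FiniteDimensional.proper_real V
  have hp := continuous_projection hc
  have hq := continuous_projection hc.symm
  let M' : ℝ := (max M 0) ^ δ⁻¹
  let T : Set V := {v | ‖Ws.projection W hc.symm v‖ = 1 ∧ ‖W.projection Ws hc v‖ ≤ M'}
  have hT : IsCompact T := by
    refine Metric.isCompact_of_isClosed_isBounded
      ((isClosed_eq hq.norm continuous_const).inter (isClosed_le hp.norm continuous_const)) ?_
    refine (Metric.isBounded_closedBall (x := (0 : V)) (r := M' + 1)).subset fun v hv => ?_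
    rw [mem_closedBall_zero_iff, ← Submodule.projection_add_projection_eq_self hc v]
    exact (norm_add_le _ _).trans (add_le_add hv.2 hv.1.le)
  have hTW : ∀ v ∈ T, v ∉ W := by
    intro v hv hvW
    have h := hv.1
    rw [(Submodule.projection_apply_eq_zero_iff hc.symm).2 hvW, norm_zero] at h
    exact zero_ne_one h
  have : CompactSpace T := isCompact_iff_compactSpace.1 hT
  have hcont : Continuous fun v : T => XVW.mk v.1 (hTW v.1 v.2) :=
    (isOpenQuotientMap_XVW_mk W).continuous.comp
      (by fun_prop : Continuous fun v : T => (⟨v.1, hTW v.1 v.2⟩ : {v : V // v ∉ W}))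
  refine (isCompact_range hcont).of_isClosed_subset
    (isClosed_le (ratioFun hc hδ).continuous continuous_const) fun x hx => ?_
  obtain ⟨v, hv, rfl⟩ := x.exists_mk_eq
  have hqv := projection_ne_zero hc hv
  set c : ℝ := ‖Ws.projection W hc.symm v‖⁻¹ with hcdef
  have hc0 : c ≠ 0 := inv_ne_zero hqv.ne'
  have hcv : c • v ∉ W := fun h => hv ((W.smul_mem_iff hc0).1 h)
  have h1 : ‖Ws.projection W hc.symm (c • v)‖ = 1 := by
    rw [map_smul, norm_smul, hcdef, norm_inv, norm_norm, inv_mul_cancel₀ hqv.ne']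
  refine ⟨⟨c • v, h1, ?_⟩, (XVW.mk_eq_mk_smul hv hc0 hcv).symm⟩
  change ratioFun hc hδ (XVW.mk v hv) ≤ M at hx
  rw [XVW.mk_eq_mk_smul hv hc0 hcv, ratioFun_mk, vecRatio, h1, Real.one_rpow, div_one] at hx
  rw [Real.le_rpow_inv_iff_of_pos (norm_nonneg _) (le_max_right _ _) hδ]
  exact hx.trans (le_max_left _ _)

theorem norm_mkQ_le_projection (hc : IsCompl W Ws) (v : V) :
    ‖W.mkQ v‖ ≤ ‖Ws.projection W hc.symm v‖ := by
  have h : W.mkQ v = W.mkQ (Ws.projection W hc.symm v) := by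
    conv_lhs => rw [← Submodule.projection_add_projection_eq_self hc v]
    rw [map_add, show W.mkQ (W.projection Ws hc v) = 0 from
      (Submodule.Quotient.mk_eq_zero W).2 (Submodule.projection_apply_mem hc v), zero_add]
  rw [h]
  exact Submodule.Quotient.norm_mk_le W _

theorem exists_projection_le_norm_mkQ (hc : IsCompl W Ws) :
    ∃ c : ℝ, 1 ≤ c ∧ ∀ v, ‖Ws.projection W hc.symm v‖ ≤ c * ‖W.mkQ v‖ := by
  let L : (V ⧸ W) →ₗ[ℝ] V := W.liftQ (Ws.projection W hc.symm) fun v hv =>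
    (Submodule.projection_apply_eq_zero_iff hc.symm).2 hv
  refine ⟨max 1 ‖LinearMap.toContinuousLinearMap L‖, le_max_left _ _, fun v => ?_⟩
  refine ((LinearMap.toContinuousLinearMap L).le_opNorm (W.mkQ v)).trans ?_
  gcongr
  exact le_max_right _ _

variable (G : Subgroup (V →L[ℝ] V)ˣ) (hW : ∀ g : G, W ≤ W.comap (stdRep G g))

theorem continuous_stdRep :
    Continuous fun g : G => LinearMap.toContinuousLinearMap (stdRep G g) := by
  rw [continuous_clm_apply]
  intro v
  exact (Units.continuous_val.comp continuous_subtype_val).clm_apply continuous_const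

theorem continuous_subrepresentation :
    Continuous fun g : G => LinearMap.toContinuousLinearMap
      ((stdRep G).subrepresentation W hW g) := by
  rw [continuous_clm_apply]
  intro w
  exact Continuous.subtype_mk (continuous_clm_apply.1 (continuous_stdRep G) w) _

theorem continuous_quotient :
    Continuous fun g : G => LinearMap.toContinuousLinearMap
      ((stdRep G).quotient W hW g) := by
  rw [continuous_clm_apply]
  intro x
  obtain ⟨v, rfl⟩ := W.mkQ_surjective x
  exact (LinearMap.continuous_of_finiteDimensional W.mkQ).comp
    (continuous_clm_apply.1 (continuous_stdRep G) v)

end Space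

/-! ### Contraction of `u_δ` -/

section Contraction

open scoped Pointwise

variable {V : Type*} [NormedAddCommGroup V] [NormedSpace ℝ V] [FiniteDimensional ℝ V]
  {W Ws : Submodule ℝ V}

/-- The action of `g` on `w + w'` is block triangular: the `W`-component of `g (w + w')` is `g w`
plus a term controlled by `w'`. -/
theorem vecRatio_stdRep_le (G : Subgroup (V →L[ℝ] V)ˣ)
    (hW : ∀ g : G, W ≤ W.comap (stdRep G g)) (hc : IsCompl W Ws) {δ : ℝ} (hδ : 0 < δ) (hδ1 : δ ≤ 1) {c : ℝ}
    (hcpos : 0 < c) (hcle : ∀ v, ‖Ws.projection W hc.symm v‖ ≤ c * ‖W.mkQ v‖)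
    (hcge : ∀ v, ‖W.mkQ v‖ ≤ ‖Ws.projection W hc.symm v‖) (g : G) {B : ℝ} (hB0 : 0 ≤ B)
    (hB : ∀ v, ‖W.projection Ws hc (stdRep G g (Ws.projection W hc.symm v))‖ ≤
      B * ‖Ws.projection W hc.symm (stdRep G g v)‖) {v : V} (hv : v ∉ W) :
    vecRatio hc δ (stdRep G g v) ≤
      (c * (‖stdRep G g (W.projection Ws hc v)‖ / ‖W.projection Ws hc v‖) /
        (‖W.mkQ (stdRep G g v)‖ / ‖W.mkQ v‖)) ^ δ * vecRatio hc δ v + B ^ δ := by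
  set w := W.projection Ws hc v with hw
  set w' := Ws.projection W hc.symm v with hw'
  have hwW : w ∈ W := Submodule.projection_apply_mem hc v
  have hgv := stdRep_apply_notMem G W hW g hv
  have hq : 0 < ‖Ws.projection W hc.symm (stdRep G g v)‖ := projection_ne_zero hc hgv
  have hw'0 : 0 < ‖w'‖ := projection_ne_zero hc hv
  have hm : ∀ {v : V}, v ∉ W → 0 < ‖W.mkQ v‖ := fun {v} hv =>
    norm_pos_iff.2 fun h => hv ((Submodule.Quotient.mk_eq_zero W).1 h)
  have hmv := hm hv
  have hmgv := hm hgv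
  have hp : W.projection Ws hc (stdRep G g v) =
      stdRep G g w + W.projection Ws hc (stdRep G g w') := by
    conv_lhs => rw [← Submodule.projection_add_projection_eq_self hc v]
    rw [map_add, map_add, Submodule.projection_apply_of_mem_left hc (hW g hwW)]
  have h1 : ‖W.projection Ws hc (stdRep G g v)‖ ≤ ‖stdRep G g w‖ +
      B * ‖Ws.projection W hc.symm (stdRep G g v)‖ := by
    rw [hp]
    exact (norm_add_le _ _).trans (add_le_add le_rfl (hB v))
  have h2 : vecRatio hc δ (stdRep G g v) ≤
      (‖stdRep G g w‖ / ‖Ws.projection W hc.symm (stdRep G g v)‖) ^ δ + B ^ δ := by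
    rw [vecRatio, ← Real.div_rpow (norm_nonneg _) (norm_nonneg _)]
    refine le_trans (Real.rpow_le_rpow (by positivity) ?_ hδ.le)
      (Real.rpow_add_le_add_rpow (by positivity) hB0 hδ.le hδ1)
    rw [div_le_iff₀ hq, add_mul, div_mul_cancel₀ _ hq.ne']
    exact h1
  refine h2.trans (add_le_add ?_ le_rfl)
  rcases eq_or_ne w 0 with hw0 | hw0
  · rw [hw0, map_zero, norm_zero, zero_div, Real.zero_rpow hδ.ne']
    refine mul_nonneg (Real.rpow_nonneg (by positivity) _) ?_
    exact div_nonneg (Real.rpow_nonneg (norm_nonneg _) _) (Real.rpow_nonneg (norm_nonneg _) _)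
  · have hwpos : 0 < ‖w‖ := norm_pos_iff.2 hw0
    rw [vecRatio, ← hw, ← hw', ← Real.div_rpow hwpos.le hw'0.le,
      ← Real.mul_rpow (by positivity) (by positivity)]
    refine Real.rpow_le_rpow (by positivity) ?_ hδ.le
    calc ‖stdRep G g w‖ / ‖Ws.projection W hc.symm (stdRep G g v)‖
        ≤ ‖stdRep G g w‖ / ‖W.mkQ (stdRep G g v)‖ := by
          gcongr
          exact hcge _
      _ ≤ ‖stdRep G g w‖ / ‖W.mkQ (stdRep G g v)‖ * (c * ‖W.mkQ v‖ / ‖w'‖) := by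
          refine le_mul_of_one_le_right (by positivity) ?_
          rw [one_le_div hw'0]
          exact hcle v
      _ = _ := by
          field_simp

theorem exists_ratioFun_contraction (G : Subgroup (V →L[ℝ] V)ˣ) [MeasurableSpace G] [BorelSpace G]
    (hW : ∀ g : G, W ≤ W.comap (stdRep G g)) (μ : Measure G) [IsProbabilityMeasure μ]
    (hμ : IsCompact μ.support)
    (hirr : IsStronglyIrreducibleOn ((stdRep G).quotient W hW) μ.support) {l l' : ℝ}
    (hl : IsFirstLyapunovExponent ((stdRep G).subrepresentation W hW) μ l)
    (hl' : IsFirstLyapunovExponent ((stdRep G).quotient W hW) μ l') (hlt : l < l')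
    (hc : IsCompl W Ws) :
    ∃ (δ : ℝ) (hδ : 0 < δ) (n : ℕ) (a b : ℝ), 1 ≤ n ∧ 0 < a ∧ a < 1 ∧ 0 < b ∧
      ∀ x, (markovOperator (action G W hW) μ hμ ^ n) (ratioFun hc hδ) x ≤
        a * ratioFun hc hδ x + b := by
  set ρ := (stdRep G).subrepresentation W hW with hρdef
  set ρ' := (stdRep G).quotient W hW with hρ'def
  have hρ := continuous_subrepresentation G hW
  have hρ' := continuous_quotient G hW
  obtain ⟨c, hc1, hcle⟩ := exists_projection_le_norm_mkQ hc
  have hc0 : 0 < c := by linarith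
  have hcge := norm_mkQ_le_projection hc
  obtain ⟨n, δ, a, hn, hδ, hδ1, ha0, ha1, hmom⟩ :=
    exists_moment_contraction ρ ρ' hρ hρ' μ hμ hirr hl hl' hlt hc0
  obtain ⟨C, hC0, hC⟩ := exists_exp_bound (stdRep G) (continuous_stdRep G) hμ
  obtain ⟨C', hC'0, hC'⟩ := exists_exp_bound ρ' hρ' hμ
  -- `B` bounds the off-diagonal block relative to the diagonal block on `V ⧸ W`
  let p : V →L[ℝ] V := LinearMap.toContinuousLinearMap (W.projection Ws hc)
  set B : ℝ := ‖p‖ * Real.exp (C * n) * (c * Real.exp (C' * n)) with hBdef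
  have hB0 : 0 ≤ B := by positivity
  have hB : ∀ g ∈ μ.support ^ n, ∀ v,
      ‖W.projection Ws hc (stdRep G g (Ws.projection W hc.symm v))‖ ≤
        B * ‖Ws.projection W hc.symm (stdRep G g v)‖ := by
    intro g hg v
    have h1 := p.le_opNorm (stdRep G g (Ws.projection W hc.symm v))
    have h2 := (hC n g hg (Ws.projection W hc.symm v)).2
    have h3 := (hC' n g hg (W.mkQ v)).1
    rw [Real.exp_neg, inv_mul_le_iff₀ (Real.exp_pos _)] at h3
    have h4 : ‖ρ' g (W.mkQ v)‖ ≤ ‖Ws.projection W hc.symm (stdRep G g v)‖ := hcge _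
    calc _ ≤ ‖p‖ * ‖stdRep G g (Ws.projection W hc.symm v)‖ := h1
      _ ≤ ‖p‖ * (Real.exp (C * n) * (c * (Real.exp (C' * n) *
          ‖Ws.projection W hc.symm (stdRep G g v)‖))) := by
        gcongr
        refine h2.trans ?_
        gcongr
        refine (hcle v).trans ?_
        gcongr
        exact h3.trans (by gcongr)
      _ = _ := by rw [hBdef]; ring
  refine ⟨δ, hδ, n, a, B ^ δ + 1, hn, ha0, ha1, by positivity, fun x => ?_⟩
  rw [markovOperator_pow_apply _ (action_one G W hW) (action_mul G W hW)]
  obtain ⟨v, hv, rfl⟩ := x.exists_mk_eq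
  have hv' : W.mkQ v ≠ 0 := fun h => hv ((Submodule.Quotient.mk_eq_zero W).1 h)
  let w : W := ⟨W.projection Ws hc v, Submodule.projection_apply_mem hc v⟩
  let κ : G → ℝ := fun g => (c * (‖ρ g w‖ / ‖w‖) / (‖ρ' g (W.mkQ v)‖ / ‖W.mkQ v‖)) ^ δ
  have hκ : Continuous κ := by
    have h1 : Continuous fun g => ‖ρ g w‖ := (continuous_clm_apply.1 hρ w).norm
    have h2 : Continuous fun g => ‖ρ' g (W.mkQ v)‖ := (continuous_clm_apply.1 hρ' (W.mkQ v)).norm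
    refine Continuous.rpow_const (Continuous.div (continuous_const.mul (h1.div_const _))
      (h2.div_const _) fun g => ?_) fun g => Or.inr hδ.le
    exact div_ne_zero (norm_ne_zero_iff.2 (rep_apply_ne_zero ρ' g hv')) (norm_ne_zero_iff.2 hv')
  have hκi := integrable_convPow μ hμ n hκ
  have hvr : 0 ≤ vecRatio hc δ v :=
    div_nonneg (Real.rpow_nonneg (norm_nonneg _) _) (Real.rpow_nonneg (norm_nonneg _) _)
  have hstep : ∫ g, ratioFun hc hδ (action G W hW (g, XVW.mk v hv)) ∂(convPow μ n) ≤
      (∫ g, κ g ∂(convPow μ n)) * vecRatio hc δ v + B ^ δ := by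
    calc _ ≤ ∫ g, (κ g * vecRatio hc δ v + B ^ δ) ∂(convPow μ n) := by
          refine integral_mono_ae (integrable_convPow μ hμ n (by fun_prop))
            ((hκi.mul_const _).add (integrable_const _)) ?_
          filter_upwards [ae_mem_pow_support μ hμ n] with g hg
          rw [action_mk G W hW g v hv (stdRep_apply_notMem G W hW g hv), ratioFun_mk]
          exact vecRatio_stdRep_le G hW hc hδ hδ1 hc0 hcle hcge g hB0 (hB g hg) hv
      _ = _ := by
          rw [integral_add (hκi.mul_const _) (integrable_const _), integral_mul_const]
          simp
  refine hstep.trans ?_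
  rw [ratioFun_mk]
  have hmain : (∫ g, κ g ∂(convPow μ n)) * vecRatio hc δ v ≤ a * vecRatio hc δ v := by
    rcases eq_or_ne w 0 with hw | hw
    · have h0 : W.projection Ws hc v = 0 := congrArg Subtype.val hw
      have : vecRatio hc δ v = 0 := by
        rw [vecRatio, h0, norm_zero, Real.zero_rpow hδ.ne', zero_div]
      rw [this, mul_zero, mul_zero]
    · exact mul_le_mul_of_nonneg_right (hmom w hw (W.mkQ v) hv') hvr
  linarith

end Contraction

end AffineRW

theorem proposition3p5 {V : Type*} [NormedAddCommGroup V] [NormedSpace ℝ V]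
    [FiniteDimensional ℝ V]
    (G : Subgroup (V →L[ℝ] V)ˣ) [MeasurableSpace G] [BorelSpace G]
    (hGalg : AffineRW.IsAlgebraicSubgroup G) (hGconn : AffineRW.IsZariskiConnected G)
    (W : Submodule ℝ V) (hW : ∀ g : G, W ≤ W.comap (AffineRW.stdRep G g))
    (hirr : ((AffineRW.stdRep G).subrepresentation W hW).IsIrreducible)
    (hprox : AffineRW.IsProximal ((AffineRW.stdRep G).subrepresentation W hW))
    (hirr' : ((AffineRW.stdRep G).quotient W hW).IsIrreducible)
    (hprox' : AffineRW.IsProximal ((AffineRW.stdRep G).quotient W hW))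
    (hneq : IsEmpty (((AffineRW.stdRep G).subrepresentation W hW).Equiv
      ((AffineRW.stdRep G).quotient W hW)))
    (hncompl : ¬ ∃ U : Submodule ℝ V,
      (∀ g : G, U ≤ U.comap (AffineRW.stdRep G g)) ∧ IsCompl W U)
    (μ : Measure G) [IsProbabilityMeasure μ]
    (hμdense : AffineRW.IsZariskiDense μ) (hμcpt : IsCompact μ.support)
    (l l' : ℝ)
    (hl : AffineRW.IsFirstLyapunovExponent ((AffineRW.stdRep G).subrepresentation W hW) μ l)
    (hl' : AffineRW.IsFirstLyapunovExponent ((AffineRW.stdRep G).quotient W hW) μ l')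
    (hlt : l < l') :
    AffineRW.UniformContraction
      (AffineRW.markovOperator (AffineRW.action G W hW) μ hμcpt) ∧
    ∀ Ws : Submodule ℝ V, IsCompl W Ws →
      ∃ (δ : ℝ) (u : C(AffineRW.XVW W, ℝ)) (n₀ : ℕ) (a b : ℝ),
        0 < δ ∧ 1 ≤ n₀ ∧ 0 < a ∧ a < 1 ∧ 0 < b ∧
        (∀ w ∈ W, ∀ w' ∈ Ws, ∀ h : w + w' ∉ W,
          u (AffineRW.XVW.mk (w + w') h) = ‖w‖ ^ δ / ‖w'‖ ^ δ) ∧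
        AffineRW.IsProperFun u ∧
        ∀ x, ((AffineRW.markovOperator (AffineRW.action G W hW) μ hμcpt) ^ n₀) u x
          ≤ a * u x + b := by
  have hstrong := AffineRW.isStronglyIrreducibleOn_quotient G hGconn W hW hirr' μ.support hμdense
  refine ⟨?_, fun Ws hc => ?_⟩
  · obtain ⟨Ws, hc⟩ := Submodule.exists_isCompl W
    obtain ⟨δ, hδ, n, a, b, hn, ha0, ha1, hb, hcontr⟩ :=
      AffineRW.exists_ratioFun_contraction G hW μ hμcpt hstrong hl hl' hlt hc
    exact AffineRW.uniformContraction_of_pow _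
      (fun f hf => AffineRW.markovOperator_nonneg _ μ hμcpt hf) _
      (AffineRW.ratioFun_nonneg hc hδ) (AffineRW.isCompact_ratioFun_le hc hδ) hn ha0 ha1 hb hcontr
  · obtain ⟨δ, hδ, n, a, b, hn, ha0, ha1, hb, hcontr⟩ :=
      AffineRW.exists_ratioFun_contraction G hW μ hμcpt hstrong hl hl' hlt hc
    refine ⟨δ, AffineRW.ratioFun hc hδ, n, a, b, hδ, hn, ha0, ha1, hb, fun w hw w' hw' h => ?_,
      AffineRW.isProperFun_of_isCompact_sublevel _ (AffineRW.isCompact_ratioFun_le hc hδ),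
      hcontr⟩
    rw [AffineRW.ratioFun_mk, AffineRW.vecRatio_add hc δ hw hw']
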